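/- **Model (CSBM-OOD).** Let $C\ge 2$ be the number of classes, $\sigma>0$, and $D=2d$. Each environment $e$ (a training environment $e^{\rm tr}$ and test environments $e^{\rm te}\in\mathcal E_{\rm te}$) is a finite graph with node set $V_e$, without isolated nodes; nodes of class $c$ have feature mean $[\mu_c;\mu_c^e]\in\mathbb R^{D}$, where $(\mu_c)_c$ (invariant) and, for each $e$, $(\mu^e_c)_c$ (spurious) are orthonormal families in $\mathbb R^{d}$. The aggregated feature $g_i$ of node $i$ is the mean of the features of its neighbours. Node $i$ has a homophilic ratio $p^{\rm hm}_i\ge 0$ and heterophilic ratios $p^{\rm ht}_i(c'|c)\ge 0$ for $c'\ne c$ (ratio of neighbours of class $c'$ when $y_i=c$), with $p_i^{\rm hm}+\sum_{c'\neq c}p_i^{\rm ht}(c'|c)=1$ for each $c$. Given $y_i=c$, the aggregated feature $g_i$ is $\mathcal N\big(p_i^{\rm hm}[\mu_c;\mu_c^e]+\sum_{c'\ne c}p_i^{\rm ht}(c'|c)[\mu_{c'};\mu_{c'}^e],\,\sigma^2 I_D\big)$, and the classes have equal prior probability. Given the aggregated features, the labels are independent with $\Pr(y_i=c\mid g_i)$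 given by Bayes' rule. **Classifiers.** $\mathcal H$ is the class of ReLU multilayer perceptrons $h$ without biases, with $L$ layers of weight matrices $W_1,\dots,W_L$, a fixed architecture with at least one hidden layer, and largest hidden width $b\ge1$; $h_i=h(g_i)\in\mathbb R^C$ and $T_h=\max_l\|W_l\|_2$. The empirical margin loss is $\widehat{\mathcal L}^\gamma_e(h)=\frac1{|V_e|}\sum_{i\in V_e}\mathbf 1\big[h_i[y_i]\le\gamma+\max_{c\ne y_i}h_i[c]\big]$, and $\mathcal L^\gamma_e(h)$ is its expectation over the labels given the aggregated features. **Notation.** For a test environment $e^{\rm te}$ put $N=|V_{e^{\rm tr}}|$, $\epsilon=\max_{j\in V_{e^{\rm te}}}\min_{i\in V_{e^{\rm tr}}}\|g_i-g_j\|_2$, $B=\max_{i\in V_{e^{\rm tr}}\cup V_{e^{\rm te}}}\|g_i\|_2>0$, and, for $i\in V_{e^{\rm tr}}$, $V^{(i)}=\{j\in V_{e^{\rm te}}:\|g_i-g_j\|_2\le\epsilon\}$. Let $$\mathrm{(a)}=\frac1{\sigma^2}\sum_{c}\sum_{c'\ne c}\Big(\sqrt{\big\|[\mu_c-\mu_{c'};\mu_c^{e^{\rm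 te}}-\mu_{c'}^{e^{\rm te}}]\big\|}+2\sqrt2\Big)\epsilon,\qquad \mathrm{(b)}=\frac{2}{\sigma^2}\sum_c (C-1)B\,\|\mu_c^{e^{\rm te}}-\mu_c^{e^{\rm tr}}\|,$$ $$\mathrm{(c)}=\frac1{2\sigma^2}\frac1{N}\sum_{i\in V_{e^{\rm tr}}}\frac1{s}\sum_{j\in V^{(i)}}\sum_c\sum_{c'\ne c}\big|p^{\rm ht}_j(c'|c)-p^{\rm ht}_i(c'|c)\big|,\qquad \mathrm{(d)}_h=\frac{b\sum_{l}\|W_l\|_F^2}{(\gamma/8)^{2/L}N^{\alpha}}\,\epsilon^{2/L},$$ $$\mathrm{const}=\frac1{N^{1-2\alpha}}+\frac1{N^{2\alpha}}\ln\frac{LC(2B)^{1/L}}{\gamma^{1/L}\delta}.$$ **Assumption 2.** The sets $V^{(i)}$, $i\in V_{e^{\rm tr}}$, are pairwise disjoint and have the same size $s\ge1$. **Assumption 3** (for $\gamma>0$, $0<\alpha<\frac14$, constants $H\ge0$ and $0<\kappa\le1$). Let $\bar v=\dfrac{(\gamma/8\epsilon)^{2/L}}{2b\,(\lambda N^{-\alpha}+\ln(2bL))}$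 with $\lambda=N^{2\alpha}$. For some $v\in[\kappa\bar v,\bar v]$, if $P$ is the law of $h$ when all weights are independent $\mathcal N(0,v)$, then $$\Pr_{h\sim P}\Big(\mathcal L^{\gamma/4}_{e^{\rm te}}(h)-\mathcal L^{\gamma/2}_{e^{\rm tr}}(h)>N^{-\alpha}+HC\epsilon\ \Big|\ T_h^L\epsilon>\tfrac\gamma8\Big)\le e^{-N^{2\alpha}}$$ (the assumption is void when $\epsilon=0$). **Theorem.** For all $C\ge2$, $\sigma>0$, $B>0$, $H\ge0$, $\kappa\in(0,1]$ there is a constant $K>0$, depending only on these, such that the following holds for every $d$, every architecture and every $\gamma>0$. 1. (Expected loss discrepancy.) For every model and every $e^{\rm te}\in\mathcal E_{\rm te}$ satisfying Assumption 2 and having maximal norm $B$, every $\lambda>0$, and every probability distribution $P$ on $\mathcal H$ with $T_h^L\epsilon\le\gamma/8$ for $P$-almost every $h$, $$\ln\mathbb E_{h\sim P}\,e^{\lambda(\mathcal L^{\gamma/4}_{e^{\rm te}}(h)-\mathcal L^{\gamma/2}_{e^{\rm tr}}(h))}\le\lambda K\big(\mathrm{(a)}+\mathrm{(b)}+\mathrm{(c)}\big).$$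 2. (Subgroup OOD generalization bound.) For all $\alpha\in(0,\frac14)$, all $\delta\in(0,1)$ such that the logarithm in $\mathrm{const}$ is positive, and every $R$, there is $N_0$ such that for every model and every $e^{\rm te}\in\mathcal E_{\rm te}$ with $N\ge N_0$ and maximal norm $B$ that satisfy Assumptions 2 and 3, with probability at least $1-\delta$ over the training labels, every $h\in\mathcal H$ with $T_h\le R$ satisfies $$\mathcal L^0_{e^{\rm te}}(h)\le\widehat{\mathcal L}^\gamma_{e^{\rm tr}}(h)+K\big(\mathrm{(a)}+\mathrm{(b)}+\mathrm{(c)}+\mathrm{(d)}_h+\mathrm{const}\big).$$ -/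

import Mathlib

open MeasureTheory ProbabilityTheory

noncomputable section

namespace SubgroupOOD

/-! ### ReLU multilayer perceptrons -/

/-- Weight matrices of a multilayer perceptron without biases, with input coordinates `ι`,
hidden layers of the widths listed in `ks`, and `C` outputs. It has `ks.length + 1` layers. -/
def Params (C : ℕ) : Type → List ℕ → Type
  | ι, [] => Fin C → ι → ℝ
  | ι, k :: ks => (Fin k → ι → ℝ) × Params C (Fin k) ks

namespace Params

variable {C : ℕ}

/-- The Borel sigma-algebra of the (finite-dimensional) parameter space. -/
@[reducible]
def measurableSpace (C : ℕ) : (ι : Type) → (ks : List ℕ) → MeasurableSpace (Params C ι ks)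
  | ι, [] => inferInstanceAs (MeasurableSpace (Fin C → ι → ℝ))
  | ι, k :: ks =>
    @Prod.instMeasurableSpace (Fin k → ι → ℝ) (Params C (Fin k) ks) inferInstance
      (measurableSpace C (Fin k) ks)

instance (ι : Type) (ks : List ℕ) : MeasurableSpace (Params C ι ks) := measurableSpace C ι ks

/-- The network map: every layer but the last one is followed by the ReLU. -/
def apply : {ι : Type} → [Fintype ι] → (ks : List ℕ) → Params C ι ks → (ι → ℝ) → Fin C → ℝ
  | _, _, [], W, x => fun c => ∑ a, W c a * x a
  | _, _, _ :: ks, W, x => apply ks W.2 (fun u => max 0 (∑ a, W.1 u a * x a))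

/-- Spectral norm of a rectangular matrix. -/
def specNorm {m ι : Type} [Fintype m] [Fintype ι] [DecidableEq ι] (A : m → ι → ℝ) : ℝ :=
  ‖(Matrix.toEuclideanLin (Matrix.of A)).toContinuousLinearMap‖

/-- `T_h`, the largest spectral norm of a weight matrix. -/
def maxSpecNorm : {ι : Type} → [Fintype ι] → [DecidableEq ι] → (ks : List ℕ) →
    Params C ι ks → ℝ
  | _, _, _, [], W => specNorm (m := Fin C) W
  | _, _, _, _ :: ks, W => max (specNorm W.1) (maxSpecNorm ks W.2)

/-- The sum of the squared Frobenius norms of the weight matrices. -/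
def sumFrobSq : {ι : Type} → [Fintype ι] → (ks : List ℕ) → Params C ι ks → ℝ
  | _, _, [], W => ∑ c : Fin C, ∑ a, (W c a) ^ 2
  | _, _, _ :: ks, W => (∑ u, ∑ a, (W.1 u a) ^ 2) + sumFrobSq ks W.2

/-- All the weights drawn independently from the centred normal distribution of variance `v`. -/
def gaussian (v : NNReal) : {ι : Type} → [Fintype ι] → (ks : List ℕ) → Measure (Params C ι ks)
  | ι, _, [] => (Measure.pi fun _ : Fin C => Measure.pi fun _ : ι => gaussianReal 0 v)
  | ι, _, k :: ks =>
    Measure.prod (α := Fin k → ι → ℝ) (β := Params C (Fin k) ks)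
      (Measure.pi fun _ : Fin k => Measure.pi fun _ : ι => gaussianReal 0 v)
      (gaussian v (ι := Fin k) ks)

end Params

/-- The number of layers. -/
def depth (ks : List ℕ) : ℕ := ks.length + 1

/-- The largest width of a hidden layer. -/
def maxWidth (ks : List ℕ) : ℕ := ks.foldr max 0

/-! ### The contextual stochastic block model -/

/-- Node features: an invariant block followed by a spurious block of the same dimension. -/
abbrev Feat (d : ℕ) : Type := EuclideanSpace ℝ (Fin d ⊕ Fin d)

/-- The concatenation `[u; v]`. -/
def concat {d : ℕ} (u v : EuclideanSpace ℝ (Fin d)) : Feat d :=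
  WithLp.toLp 2 (Sum.elim (fun k => u k) (fun k => v k))

/-- An environment: a finite graph with node features (as observed), the spurious means of the
classes, and for each node the ratios of the classes among its neighbours.
`pHm i` is the homophilic ratio, and `pHt i c c'` is the ratio of neighbours of class `c'` when
node `i` has class `c`; the value for `c' = c` is never used. -/
structure Environment (d C : ℕ) where
  V : Type
  [fintypeV : Fintype V]
  [nonemptyV : Nonempty V]
  graph : SimpleGraph V
  exists_adj : ∀ i, ∃ j, graph.Adj i j
  feature : V → Feat d
  muSp : Fin C → EuclideanSpace ℝ (Fin d)
  orthonormal_muSp : Orthonormal ℝ muSp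
  pHm : V → ℝ
  pHt : V → Fin C → Fin C → ℝ
  pHm_nonneg : ∀ i, 0 ≤ pHm i
  pHt_nonneg : ∀ i c c', c' ≠ c → 0 ≤ pHt i c c'
  sum_ratio : ∀ i c, pHm i + ∑ c' ∈ Finset.univ.filter (fun c' => c' ≠ c), pHt i c c' = 1

attribute [instance] Environment.fintypeV Environment.nonemptyV

/-- The model: invariant class means, shared by all the environments, a training environment, and
a family of test environments; `σ` is the standard deviation of the features of a class. -/
structure CSBM (d C : ℕ) (σ : ℝ) where
  mu : Fin C → EuclideanSpace ℝ (Fin d)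
  orthonormal_mu : Orthonormal ℝ mu
  train : Environment d C
  Test : Type
  test : Test → Environment d C

namespace Environment

variable {d C : ℕ}

/-- The number of nodes. -/
def size (E : Environment d C) : ℕ := Fintype.card E.V

open Classical in
/-- The one-hop neighbours of a node. -/
def neighbors (E : Environment d C) (i : E.V) : Finset E.V :=
  Finset.univ.filter fun j => E.graph.Adj i j

/-- The aggregated feature `g_i`: the mean of the features of the neighbours. -/
def agg (E : Environment d C) (i : E.V) : Feat d :=
  ((E.neighbors i).card : ℝ)⁻¹ • ∑ j ∈ E.neighbors i, E.feature j

end Environment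

namespace CSBM

variable {d C : ℕ} {σ : ℝ}

/-- The mean `[μ_c; μ_c^e]` of the features of the nodes of class `c` in an environment. -/
def featMean (M : CSBM d C σ) (E : Environment d C) (c : Fin C) : Feat d :=
  concat (M.mu c) (E.muSp c)

/-- The mean of the aggregated feature of node `i` when its class is `c`. -/
def aggMean (M : CSBM d C σ) (E : Environment d C) (i : E.V) (c : Fin C) : Feat d :=
  E.pHm i • M.featMean E c +
    ∑ c' ∈ Finset.univ.filter (fun c' => c' ≠ c), E.pHt i c c' • M.featMean E c'

/-- `Pr(g_i = z | y_i = c)`: the density of the normal distribution on `ℝ^(2d)` with mean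
`aggMean` and covariance `σ ^ 2` times the identity. -/
def density (M : CSBM d C σ) (E : Environment d C) (i : E.V) (c : Fin C) (z : Feat d) : ℝ :=
  (Real.sqrt ((2 * Real.pi * σ ^ 2) ^ (2 * d)))⁻¹ *
    Real.exp (-(‖z - M.aggMean E i c‖ ^ 2 / (2 * σ ^ 2)))

/-- `Pr(y_i = c | g_i)`, by the rule of Bayes; the classes have the same prior probability. -/
def posterior (M : CSBM d C σ) (E : Environment d C) (i : E.V) (c : Fin C) : ℝ :=
  ((C : ℝ)⁻¹ * M.density E i c (E.agg i)) / ∑ c', (C : ℝ)⁻¹ * M.density E i c' (E.agg i)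

/-- The law of the label of node `i` given the aggregated feature. -/
def nodeLabelLaw (M : CSBM d C σ) (E : Environment d C) (i : E.V) : Measure (Fin C) :=
  ∑ c, ENNReal.ofReal (M.posterior E i c) • Measure.dirac c

/-- The law of all the labels of an environment given the aggregated features: the labels are
independent. -/
def labelLaw (M : CSBM d C σ) (E : Environment d C) : Measure (E.V → Fin C) :=
  Measure.pi fun i => M.nodeLabelLaw E i

end CSBM

/-! ### Margin losses -/

open Classical in
/-- `1[z_y ≤ γ + max_{c ≠ y} z_c]`. -/
def marginLoss {C : ℕ} (γ : ℝ) (z : Fin C → ℝ) (y : Fin C) : ℝ :=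
  if z y ≤ γ + ⨆ c : {c : Fin C // c ≠ y}, z c then 1 else 0

/-- The logits of node `i`: the perceptron applied to the aggregated feature. -/
def logits {d C : ℕ} (E : Environment d C) (ks : List ℕ) (W : Params C (Fin d ⊕ Fin d) ks)
    (i : E.V) : Fin C → ℝ :=
  Params.apply ks W (fun k => E.agg i k)

/-- The empirical margin loss for the labels `y`. -/
def empLoss {d C : ℕ} (E : Environment d C) (ks : List ℕ) (γ : ℝ)
    (W : Params C (Fin d ⊕ Fin d) ks) (y : E.V → Fin C) : ℝ :=
  (1 / (E.size : ℝ)) * ∑ i, marginLoss γ (logits E ks W i) (y i)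

namespace CSBM

variable {d C : ℕ} {σ : ℝ}

/-- The expected margin loss. -/
def expLoss (M : CSBM d C σ) (E : Environment d C) (ks : List ℕ) (γ : ℝ)
    (W : Params C (Fin d ⊕ Fin d) ks) : ℝ :=
  ∫ y, empLoss E ks γ W y ∂(M.labelLaw E)

/-! ### Comparison of the training environment with a test environment -/

/-- The aggregated-feature distance `max_{j test} min_{i train} ‖g_i - g_j‖`. -/
def dist (M : CSBM d C σ) (e : M.Test) : ℝ :=
  ⨆ j : (M.test e).V, ⨅ i : M.train.V, ‖M.train.agg i - (M.test e).agg j‖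

/-- The largest norm of an aggregated feature of a training or test node. -/
def maxNorm (M : CSBM d C σ) (e : M.Test) : ℝ :=
  max (⨆ i : M.train.V, ‖M.train.agg i‖) (⨆ j : (M.test e).V, ‖(M.test e).agg j‖)

open Classical in
/-- The test nodes near the training node `i`. -/
def near (M : CSBM d C σ) (e : M.Test) (i : M.train.V) : Finset (M.test e).V :=
  Finset.univ.filter fun j => ‖M.train.agg i - (M.test e).agg j‖ ≤ M.dist e

/-- Equal-sized and disjoint near sets; `s` is the common size. -/
def NearSets (M : CSBM d C σ) (e : M.Test) (s : ℕ) : Prop :=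
  0 < s ∧ (∀ i, (M.near e i).card = s) ∧
    ∀ i i', i ≠ i' → Disjoint (M.near e i) (M.near e i')

/-- The upper bound `(γ / (8 ε))^(2/L) / (2 b (λ N^(-α) + ln (2 b L)))` for the prior variance, with
`λ = N^(2α)`, where `N` is the number of training nodes. -/
def priorVarBound (M : CSBM d C σ) (e : M.Test) (ks : List ℕ) (γ α : ℝ) : ℝ :=
  (γ / (8 * M.dist e)) ^ (2 / (depth ks : ℝ)) /
    (2 * maxWidth ks * ((M.train.size : ℝ) ^ (2 * α) * (M.train.size : ℝ) ^ (-α) +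
      Real.log (2 * maxWidth ks * depth ks)))

/-- Concentrated expected loss difference: for a Gaussian prior `P` whose variance is at most
`priorVarBound`, and at least the fraction `κ` of it, conditionally on `T_h ^ L * ε > γ / 8`, the
loss difference exceeds `N^(-α) + H C ε` with probability at most `exp (-N^(2α))`. -/
def Concentrated (M : CSBM d C σ) (e : M.Test) (ks : List ℕ) (γ α H κ : ℝ) : Prop :=
  ∃ v : ℝ, κ * M.priorVarBound e ks γ α ≤ v ∧ v ≤ M.priorVarBound e ks γ α ∧
    (ProbabilityTheory.cond (Params.gaussian (C := C) v.toNNReal (ι := Fin d ⊕ Fin d) ks)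
      {W | γ / 8 < Params.maxSpecNorm ks W ^ depth ks * M.dist e}).real
      {W | (M.train.size : ℝ) ^ (-α) + H * C * M.dist e <
        M.expLoss (M.test e) ks (γ / 4) W - M.expLoss M.train ks (γ / 2) W} ≤
    Real.exp (-(M.train.size : ℝ) ^ (2 * α))

/-- The expected loss discrepancy `ln E_{h ∼ P} exp (λ (L_te^(γ/2)(h) - L_tr^γ(h)))`. -/
def discrepancy (M : CSBM d C σ) (e : M.Test) (ks : List ℕ) (γ lam : ℝ)
    (P : Measure (Params C (Fin d ⊕ Fin d) ks)) : ℝ :=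
  Real.log (∫ W, Real.exp
    (lam * (M.expLoss (M.test e) ks (γ / 2) W - M.expLoss M.train ks γ W)) ∂P)

/-! ### The terms of the bound -/

/-- Class separability times aggregated-feature distance. -/
def termA (M : CSBM d C σ) (e : M.Test) : ℝ :=
  1 / σ ^ 2 * ((∑ c : Fin C, ∑ c' ∈ Finset.univ.filter (fun c' => c' ≠ c),
    (Real.sqrt ‖concat (M.mu c - M.mu c') ((M.test e).muSp c - (M.test e).muSp c')‖ +
      2 * Real.sqrt 2)) * M.dist e)

/-- Shift of the spurious means. -/
def termB (M : CSBM d C σ) (e : M.Test) : ℝ :=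
  1 / σ ^ 2 * (2 * ∑ c : Fin C,
    ((C : ℝ) - 1) * M.maxNorm e * ‖(M.test e).muSp c - M.train.muSp c‖)

/-- Shift of the label distributions of the heterophilic neighbours. -/
def termC (M : CSBM d C σ) (e : M.Test) (s : ℕ) : ℝ :=
  1 / (2 * σ ^ 2) * ((1 / (M.train.size : ℝ)) * ∑ i : M.train.V,
    (1 / (s : ℝ)) * ∑ j ∈ M.near e i,
      ∑ c : Fin C, ∑ c' ∈ Finset.univ.filter (fun c' => c' ≠ c),
        |(M.test e).pHt j c c' - M.train.pHt i c c'|)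

/-- The weight-norm term. -/
def termD (M : CSBM d C σ) (e : M.Test) (ks : List ℕ) (γ α : ℝ)
    (W : Params C (Fin d ⊕ Fin d) ks) : ℝ :=
  (maxWidth ks * Params.sumFrobSq ks W) /
      ((γ / 8) ^ (2 / (depth ks : ℝ)) * (M.train.size : ℝ) ^ α) *
    M.dist e ^ (2 / (depth ks : ℝ))

/-- The argument `L C (2B)^(1/L) / (γ^(1/L) δ)` of the logarithm in the constant term. -/
def logArg (C : ℕ) (ks : List ℕ) (B γ δ : ℝ) : ℝ :=
  (depth ks : ℝ) * C * (2 * B) ^ (1 / (depth ks : ℝ)) / (γ ^ (1 / (depth ks : ℝ)) * δ)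

/-- The constant term. -/
def termConst (M : CSBM d C σ) (e : M.Test) (ks : List ℕ) (γ α δ : ℝ) : ℝ :=
  1 / (M.train.size : ℝ) ^ (1 - 2 * α) +
    1 / (M.train.size : ℝ) ^ (2 * α) * Real.log (logArg C ks (M.maxNorm e) γ δ)

end CSBM

end SubgroupOOD

end

noncomputable section

namespace SubgroupOOD

/-! ### The spectral norm -/

section SpecNorm

variable {m ι : Type} [Fintype m] [Fintype ι] [DecidableEq ι]

/-! A fixed perceptron already satisfies a deterministic comparison, so the exponential moment in
the first claim is bounded pointwise. The near sets partition the test nodes into blocks of equal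
size, hence a test loss is an average over training nodes of averages over near nodes. For a near
pair, the Lipschitz bound `Params.norm_apply_sub_apply_le` moves the logits by at most `T_h^L ε`,
which a change of margin absorbs. The posteriors differ only through log-densities, controlled by
`ε`, the shift of the spurious means and the shift of the ratios. The result is
`CSBM.expLoss_test_le`.

For the second claim, the empirical loss at margin `γ` controls the expected training loss at margin
`3γ/4`, uniformly over `T_h ≤ R`: Chebyshev's inequality on a finite net whose size does not depend
on `N` (`CSBM.exists_le_labelLaw_forall`). It remains to compare the test loss at margin `0` with
the expected training loss at margin `3γ/4`. If `T_h^L ε ≤ γ/8`, the deterministic comparison does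
this.

If `T_h^L ε > γ/8`, Assumption 3 is turned from a statement about most random networks into one
about every network (`CSBM.exists_expLoss_test_le_of_concentrated`). A small box of weights near
`h`, lying inside the conditioning event, has Gaussian mass at least `exp(-O(N^α))`, more than the
exceptional probability `exp(-N^(2α))`. The box therefore contains a good network, and its logits
are within `γ/8` of those of `h`. The error `N^(-α) + H C ε` is absorbed by (d) and (a), since
`T_h^L ε > γ/8` forces the weight norms to be large. -/

theorem specNorm_nonneg (A : m → ι → ℝ) : 0 ≤ Params.specNorm A := norm_nonneg _

theorem toEuclideanLin_of_apply (A : m → ι → ℝ) (x : ι → ℝ) :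
    Matrix.toEuclideanLin (Matrix.of A) (WithLp.toLp 2 x) =
      WithLp.toLp 2 (fun u => ∑ a, A u a * x a) := by
  ext u
  simp [Matrix.toEuclideanLin, Matrix.mulVec, dotProduct]

theorem norm_mulVec_le_specNorm (A : m → ι → ℝ) (x : ι → ℝ) :
    ‖(WithLp.toLp 2 (fun u => ∑ a, A u a * x a) : EuclideanSpace ℝ m)‖ ≤
      Params.specNorm A * ‖(WithLp.toLp 2 x : EuclideanSpace ℝ ι)‖ := by
  rw [← toEuclideanLin_of_apply]
  exact (LinearMap.toContinuousLinearMap (Matrix.toEuclideanLin (Matrix.of A))).le_opNorm _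

theorem abs_apply_le_norm_toLp (x : ι → ℝ) (a : ι) :
    |x a| ≤ ‖(WithLp.toLp 2 x : EuclideanSpace ℝ ι)‖ :=
  PiLp.norm_apply_le (WithLp.toLp 2 x : EuclideanSpace ℝ ι) a

theorem abs_entry_le_specNorm [DecidableEq m] (A : m → ι → ℝ) (u : m) (a : ι) :
    |A u a| ≤ Params.specNorm A := by
  have h := norm_mulVec_le_specNorm A (Pi.single a 1)
  have h1 : ‖(WithLp.toLp 2 (Pi.single a 1) : EuclideanSpace ℝ ι)‖ = 1 := by
    simp
  rw [h1, mul_one] at h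
  refine le_trans ?_ h
  have := abs_apply_le_norm_toLp (fun u => ∑ b, A u b * (Pi.single a 1 : ι → ℝ) b) u
  simpa [Pi.single_apply] using this

/-- Cauchy–Schwarz in each row. -/
theorem specNorm_le_sqrt (A : m → ι → ℝ) :
    Params.specNorm A ≤ Real.sqrt (∑ u, ∑ a, A u a ^ 2) := by
  refine ContinuousLinearMap.opNorm_le_bound _ (Real.sqrt_nonneg _) fun x => ?_
  obtain ⟨x, rfl⟩ := (WithLp.toLp_surjective 2) x
  change ‖Matrix.toEuclideanLin (Matrix.of A) (WithLp.toLp 2 x)‖ ≤ _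
  rw [toEuclideanLin_of_apply, EuclideanSpace.norm_eq, EuclideanSpace.norm_eq,
    ← Real.sqrt_mul (by positivity)]
  refine Real.sqrt_le_sqrt ?_
  rw [Finset.sum_mul]
  refine Finset.sum_le_sum fun u _ => ?_
  simpa using Finset.sum_mul_sq_le_sq_mul_sq Finset.univ (A u) x

theorem specNorm_sq_le (A : m → ι → ℝ) : Params.specNorm A ^ 2 ≤ ∑ u, ∑ a, A u a ^ 2 :=
  (Real.le_sqrt (specNorm_nonneg A) (by positivity)).1 (specNorm_le_sqrt A)

theorem specNorm_smul {t : ℝ} (ht : 0 ≤ t) (A : m → ι → ℝ) :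
    Params.specNorm (fun u a => t * A u a) = t * Params.specNorm A := by
  unfold Params.specNorm
  have : Matrix.toEuclideanLin (Matrix.of fun u a => t * A u a) =
      t • Matrix.toEuclideanLin (Matrix.of A) := by
    rw [← map_smul]; rfl
  rw [this, map_smul, norm_smul, Real.norm_of_nonneg ht]

theorem specNorm_le_add_sub (A A' : m → ι → ℝ) :
    Params.specNorm A ≤ Params.specNorm A' + Params.specNorm (fun u a => A u a - A' u a) := by
  unfold Params.specNorm
  have : Matrix.toEuclideanLin (Matrix.of A) = Matrix.toEuclideanLin (Matrix.of A') +
      Matrix.toEuclideanLin (Matrix.of fun u a => A u a - A' u a) := by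
    rw [← map_add]
    congr 1
    ext u a
    simp
  rw [this, map_add]
  exact norm_add_le _ _

theorem specNorm_le_add_of_abs_sub_le {r : ℝ} (hr : 0 ≤ r) (A A' : m → ι → ℝ)
    (h : ∀ u a, |A u a - A' u a| ≤ r) :
    Params.specNorm A ≤
      Params.specNorm A' + Real.sqrt (Fintype.card m * Fintype.card ι) * r := by
  refine (specNorm_le_add_sub A A').trans (add_le_add le_rfl ((specNorm_le_sqrt _).trans ?_))
  rw [show Real.sqrt (Fintype.card m * Fintype.card ι) * r =
    Real.sqrt (Fintype.card m * Fintype.card ι * r ^ 2) by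
      rw [Real.sqrt_mul (by positivity) (r ^ 2), Real.sqrt_sq hr]]
  refine Real.sqrt_le_sqrt ?_
  calc ∑ u, ∑ a, (A u a - A' u a) ^ 2 ≤ ∑ _u : m, ∑ _a : ι, r ^ 2 :=
        Finset.sum_le_sum fun u _ => Finset.sum_le_sum fun a _ =>
          sq_le_sq' (by linarith [(abs_le.1 (h u a)).1]) (abs_le.1 (h u a)).2
    _ = _ := by simp [mul_assoc]

end SpecNorm

namespace Params

variable {C : ℕ}

/-! ### Entrywise comparison of parameters -/

/-- All the weights are at most `R` in absolute value. -/
def EntriesLE (R : ℝ) : {ι : Type} → (ks : List ℕ) → Params C ι ks → Prop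
  | _, [], W => ∀ c a, |W c a| ≤ R
  | _, _ :: ks, W => (∀ u a, |W.1 u a| ≤ R) ∧ EntriesLE R ks W.2

/-- Corresponding weights differ by at most `r`. -/
def Close (r : ℝ) : {ι : Type} → (ks : List ℕ) → Params C ι ks → Params C ι ks → Prop
  | _, [], U, W => ∀ c a, |U c a - W c a| ≤ r
  | _, _ :: ks, U, W => (∀ u a, |U.1 u a - W.1 u a| ≤ r) ∧ Close r ks U.2 W.2

/-- All the weights multiplied by `t`. -/
def scale (t : ℝ) : {ι : Type} → (ks : List ℕ) → Params C ι ks → Params C ι ks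
  | _, [], W => fun c a => t * W c a
  | _, _ :: ks, W => (fun u a => t * W.1 u a, scale t ks W.2)

theorem EntriesLE.mono {R R' : ℝ} (h : R ≤ R') : ∀ {ι : Type} (ks : List ℕ) {W : Params C ι ks},
    EntriesLE R ks W → EntriesLE R' ks W
  | _, [], _, hW => fun c a => (hW c a).trans h
  | _, _ :: ks, _, hW => ⟨fun u a => (hW.1 u a).trans h, EntriesLE.mono h ks hW.2⟩

theorem Close.mono {r r' : ℝ} (h : r ≤ r') : ∀ {ι : Type} (ks : List ℕ) {W W' : Params C ι ks},
    Close r ks W W' → Close r' ks W W'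
  | _, [], _, _, hW => fun c a => (hW c a).trans h
  | _, _ :: ks, _, _, hW => ⟨fun u a => (hW.1 u a).trans h, Close.mono h ks hW.2⟩

theorem Close.trans {r r' : ℝ} : ∀ {ι : Type} (ks : List ℕ) {W W' W'' : Params C ι ks},
    Close r ks W W' → Close r' ks W' W'' → Close (r + r') ks W W''
  | _, [], _, _, _, h, h' => fun c a =>
      (abs_sub_le _ _ _).trans (add_le_add (h c a) (h' c a))
  | _, _ :: ks, _, _, _, h, h' => ⟨fun u a =>
      (abs_sub_le _ _ _).trans (add_le_add (h.1 u a) (h'.1 u a)), Close.trans ks h.2 h'.2⟩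

theorem EntriesLE.of_close {R r : ℝ} : ∀ {ι : Type} (ks : List ℕ) {W W' : Params C ι ks},
    EntriesLE R ks W → Close r ks W W' → EntriesLE (R + r) ks W'
  | _, [], W, W', h, h' => fun c a => by
      have := abs_le.1 (h c a); have := abs_le.1 (h' c a)
      exact abs_le.2 ⟨by linarith, by linarith⟩
  | _, _ :: ks, W, W', h, h' => ⟨fun u a => by
      have := abs_le.1 (h.1 u a); have := abs_le.1 (h'.1 u a)
      exact abs_le.2 ⟨by linarith, by linarith⟩, EntriesLE.of_close ks h.2 h'.2⟩

theorem close_scale {R t : ℝ} (ht : 0 ≤ t) : ∀ {ι : Type} (ks : List ℕ) {W : Params C ι ks},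
    EntriesLE R ks W → Close (t * R) ks W (scale (1 + t) ks W)
  | _, [], W, h => fun c a => by
      change |W c a - (1 + t) * W c a| ≤ _
      rw [show W c a - (1 + t) * W c a = -(t * W c a) by ring, abs_neg, abs_mul, abs_of_nonneg ht]
      exact mul_le_mul_of_nonneg_left (h c a) ht
  | _, _ :: ks, W, h => ⟨fun u a => by
      change |W.1 u a - (1 + t) * W.1 u a| ≤ _
      rw [show W.1 u a - (1 + t) * W.1 u a = -(t * W.1 u a) by ring, abs_neg, abs_mul,
        abs_of_nonneg ht]
      exact mul_le_mul_of_nonneg_left (h.1 u a) ht, close_scale ht ks h.2⟩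

/-! ### The largest spectral norm -/

theorem maxSpecNorm_nonneg : ∀ {ι : Type} [Fintype ι] [DecidableEq ι] (ks : List ℕ)
    (W : Params C ι ks), 0 ≤ maxSpecNorm ks W
  | _, _, _, [], W => specNorm_nonneg (m := Fin C) W
  | _, _, _, _ :: _, W => le_max_of_le_left (specNorm_nonneg W.1)

theorem entriesLE_of_maxSpecNorm_le {R : ℝ} : ∀ {ι : Type} [Fintype ι] [DecidableEq ι]
    (ks : List ℕ) {W : Params C ι ks}, maxSpecNorm ks W ≤ R → EntriesLE R ks W
  | _, _, _, [], W, h => fun c a => (abs_entry_le_specNorm (m := Fin C) W c a).trans h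
  | _, _, _, _ :: ks, W, h =>
    ⟨fun u a => (abs_entry_le_specNorm W.1 u a).trans ((le_max_left _ _).trans h),
      entriesLE_of_maxSpecNorm_le ks ((le_max_right _ _).trans h)⟩

theorem maxSpecNorm_scale {t : ℝ} (ht : 0 ≤ t) : ∀ {ι : Type} [Fintype ι] [DecidableEq ι]
    (ks : List ℕ) (W : Params C ι ks), maxSpecNorm ks (scale t ks W) = t * maxSpecNorm ks W
  | _, _, _, [], W => specNorm_smul (m := Fin C) ht W
  | _, _, _, _ :: ks, W => by
      change max (specNorm fun u a => t * W.1 u a) (maxSpecNorm ks (scale t ks W.2)) =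
        t * max (specNorm W.1) (maxSpecNorm ks W.2)
      rw [specNorm_smul ht, maxSpecNorm_scale ht ks, mul_max_of_nonneg _ _ ht]

/-- `D` depends on the architecture alone, so one box radius can serve all networks in the scaling
argument. -/
theorem exists_maxSpecNorm_le_add : ∀ (ι : Type) [Fintype ι] [DecidableEq ι] (ks : List ℕ),
    ∃ D : ℝ, 0 < D ∧ ∀ (r : ℝ), 0 ≤ r → ∀ W W' : Params C ι ks, Close r ks W W' →
      maxSpecNorm ks W ≤ maxSpecNorm ks W' + D * r
  | ι, _, _, [] => by
      refine ⟨Real.sqrt (Fintype.card (Fin C) * Fintype.card ι) + 1, by positivity,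
        fun r hr W W' h => ?_⟩
      have := specNorm_le_add_of_abs_sub_le (m := Fin C) hr W W' h
      change specNorm (m := Fin C) W ≤ specNorm (m := Fin C) W' + _
      linarith
  | ι, _, _, k :: ks => by
      obtain ⟨D, hD, hks⟩ := exists_maxSpecNorm_le_add (Fin k) ks
      refine ⟨Real.sqrt (Fintype.card (Fin k) * Fintype.card ι) + D, by positivity,
        fun r hr W W' h => ?_⟩
      have h1 := specNorm_le_add_of_abs_sub_le hr W.1 W'.1 h.1
      have h2 := hks r hr W.2 W'.2 h.2
      have h3 := Real.sqrt_nonneg (Fintype.card (Fin k) * Fintype.card ι : ℝ)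
      change max (specNorm W.1) (maxSpecNorm ks W.2) ≤
        max (specNorm W'.1) (maxSpecNorm ks W'.2) + _
      refine max_le ?_ ?_
      · nlinarith [le_max_left (specNorm W'.1) (maxSpecNorm ks W'.2), mul_nonneg hD.le hr]
      · nlinarith [le_max_right (specNorm W'.1) (maxSpecNorm ks W'.2), mul_nonneg h3 hr]

theorem sumFrobSq_nonneg : ∀ {ι : Type} [Fintype ι] [DecidableEq ι] (ks : List ℕ)
    (W : Params C ι ks), 0 ≤ sumFrobSq ks W
  | _, _, _, [], _ => Finset.sum_nonneg fun _ _ => Finset.sum_nonneg fun _ _ => sq_nonneg _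
  | _, _, _, _ :: ks, W => add_nonneg
      (Finset.sum_nonneg fun _ _ => Finset.sum_nonneg fun _ _ => sq_nonneg _)
      (sumFrobSq_nonneg ks W.2)

theorem maxSpecNorm_sq_le : ∀ {ι : Type} [Fintype ι] [DecidableEq ι] (ks : List ℕ)
    (W : Params C ι ks), maxSpecNorm ks W ^ 2 ≤ sumFrobSq ks W
  | _, _, _, [], W => specNorm_sq_le (m := Fin C) W
  | _, _, _, _ :: ks, W => by
      have h1 := specNorm_sq_le W.1
      have h2 := maxSpecNorm_sq_le ks W.2
      have h3 := sumFrobSq_nonneg ks W.2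
      have h4 : 0 ≤ ∑ u, ∑ a, W.1 u a ^ 2 := by positivity
      change max (specNorm W.1) (maxSpecNorm ks W.2) ^ 2 ≤
        (∑ u, ∑ a, W.1 u a ^ 2) + sumFrobSq ks W.2
      rcases max_choice (specNorm W.1) (maxSpecNorm ks W.2) with h | h <;> rw [h] <;> linarith

/-! ### Continuity of the network map -/

theorem norm_toLp_mono {ι : Type} [Fintype ι] {x y : ι → ℝ} (h : ∀ a, |x a| ≤ |y a|) :
    ‖(WithLp.toLp 2 x : EuclideanSpace ℝ ι)‖ ≤ ‖(WithLp.toLp 2 y : EuclideanSpace ℝ ι)‖ := by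
  rw [EuclideanSpace.norm_eq, EuclideanSpace.norm_eq]
  refine Real.sqrt_le_sqrt (Finset.sum_le_sum fun a _ => ?_)
  exact pow_le_pow_left₀ (norm_nonneg _) (h a) 2

/-- Each layer is Lipschitz with constant its spectral norm, and the ReLU does not increase
coordinatewise differences; induct on the layers. -/
theorem norm_apply_sub_apply_le {T : ℝ} : ∀ {ι : Type} [Fintype ι] [DecidableEq ι] (ks : List ℕ)
    (W : Params C ι ks), maxSpecNorm ks W ≤ T → ∀ x x' : ι → ℝ,
    ‖(WithLp.toLp 2 (fun c => apply ks W x c - apply ks W x' c) : EuclideanSpace ℝ (Fin C))‖ ≤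
      T ^ depth ks * ‖(WithLp.toLp 2 (fun a => x a - x' a) : EuclideanSpace ℝ ι)‖
  | ι, _, _, [], W, hT, x, x' => by
      have h := norm_mulVec_le_specNorm (m := Fin C) W (fun a => x a - x' a)
      have e : (fun c => apply [] W x c - apply [] W x' c) =
          fun c => ∑ a, W c a * (x a - x' a) := by
        funext c
        simp [apply, mul_sub]
      rw [e]
      refine h.trans (mul_le_mul_of_nonneg_right ?_ (norm_nonneg _))
      change specNorm (m := Fin C) W ≤ T at hT
      simpa [depth] using hT
  | ι, _, _, k :: ks, W, hT, x, x' => by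
      have hT0 : 0 ≤ T := (maxSpecNorm_nonneg _ W).trans hT
      have h1 := norm_apply_sub_apply_le ks W.2 ((le_max_right _ _).trans hT)
        (fun u => max 0 (∑ a, W.1 u a * x a)) (fun u => max 0 (∑ a, W.1 u a * x' a))
      have h2 := norm_mulVec_le_specNorm W.1 (fun a => x a - x' a)
      have h3 : ‖(WithLp.toLp 2 (fun u => max 0 (∑ a, W.1 u a * x a) -
          max 0 (∑ a, W.1 u a * x' a)) : EuclideanSpace ℝ (Fin k))‖ ≤
          ‖(WithLp.toLp 2 (fun u => ∑ a, W.1 u a * (x a - x' a)) : EuclideanSpace ℝ (Fin k))‖ := by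
        refine norm_toLp_mono fun u => ?_
        have : ∑ a, W.1 u a * (x a - x' a) = ∑ a, W.1 u a * x a - ∑ a, W.1 u a * x' a := by
          simp [mul_sub]
        rw [this, max_comm 0, max_comm 0]
        exact abs_max_sub_max_le_abs _ _ _
      have h4 : specNorm W.1 ≤ T := (le_max_left _ _).trans hT
      refine h1.trans ?_
      calc T ^ depth ks * _ ≤ T ^ depth ks *
          (T * ‖(WithLp.toLp 2 (fun a => x a - x' a) : EuclideanSpace ℝ ι)‖) := by
            refine mul_le_mul_of_nonneg_left (h3.trans (h2.trans ?_)) (by positivity)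
            exact mul_le_mul_of_nonneg_right h4 (norm_nonneg _)
        _ = _ := by
            rw [show depth (k :: ks) = depth ks + 1 by simp [depth], pow_succ, mul_assoc]

theorem abs_sum_mul_sub_sum_mul_le {ι : Type} [Fintype ι] {B R ρ : ℝ} {w w' x x' : ι → ℝ}
    (hw' : ∀ a, |w' a| ≤ R) (hx : ∀ a, |x a| ≤ B) (hw : ∀ a, |w a - w' a| ≤ ρ)
    (hxx : ∀ a, |x a - x' a| ≤ ρ) :
    |∑ a, w a * x a - ∑ a, w' a * x' a| ≤ Fintype.card ι * (ρ * (B + R)) := by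
  rw [← Finset.sum_sub_distrib]
  refine (Finset.abs_sum_le_sum_abs _ _).trans ?_
  have : ∀ a ∈ Finset.univ, |w a * x a - w' a * x' a| ≤ ρ * (B + R) := fun a _ => by
    have e : w a * x a - w' a * x' a = (w a - w' a) * x a + w' a * (x a - x' a) := by ring
    rw [e]
    refine (abs_add_le _ _).trans ?_
    rw [abs_mul, abs_mul]
    have hρ := (abs_nonneg _).trans (hw a)
    have h1 := mul_le_mul (hw a) (hx a) (abs_nonneg _) hρ
    have h2 := mul_le_mul (hw' a) (hxx a) (abs_nonneg _) ((abs_nonneg _).trans (hw' a))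
    linarith
  simpa using Finset.sum_le_card_nsmul _ _ _ this

theorem abs_sum_mul_le {ι : Type} [Fintype ι] {B R : ℝ} {w x : ι → ℝ}
    (hw : ∀ a, |w a| ≤ R) (hx : ∀ a, |x a| ≤ B) :
    |∑ a, w a * x a| ≤ Fintype.card ι * (R * B) := by
  refine (Finset.abs_sum_le_sum_abs _ _).trans ?_
  have : ∀ a ∈ Finset.univ, |w a * x a| ≤ R * B := fun a _ => by
    rw [abs_mul]
    exact mul_le_mul (hw a) (hx a) (abs_nonneg _) ((abs_nonneg _).trans (hw a))
  simpa using Finset.sum_le_card_nsmul _ _ _ this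

/-- Induction on the layers. The input has to vary together with the weights, because after one
layer the two networks see different hidden vectors; the bound `B` on the input becomes `card ι * (R
* B)` for the next layer. -/
theorem exists_close_apply {R : ℝ} (hR : 0 ≤ R) : ∀ (ι : Type) [Fintype ι] (ks : List ℕ)
    {B η : ℝ}, 0 ≤ B → 0 < η →
    ∃ ρ : ℝ, 0 < ρ ∧ ∀ W W' : Params C ι ks, EntriesLE R ks W → EntriesLE R ks W' →
      Close ρ ks W W' → ∀ x x' : ι → ℝ, (∀ a, |x a| ≤ B) → (∀ a, |x a - x' a| ≤ ρ) →
        ∀ c, |apply ks W x c - apply ks W' x' c| ≤ η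
  | ι, _, [], B, η, hB, hη => by
      have hD : 0 < Fintype.card ι * (B + R) + 1 := by positivity
      refine ⟨η / (Fintype.card ι * (B + R) + 1), by positivity,
        fun W W' _ hW' hWW x x' hx hxx c => ?_⟩
      refine (abs_sum_mul_sub_sum_mul_le (hW' c) hx (hWW c) hxx).trans ?_
      rw [mul_left_comm, div_mul_eq_mul_div, div_le_iff₀ hD]
      nlinarith
  | ι, _, k :: ks, B, η, hB, hη => by
      obtain ⟨ρ, hρ, h⟩ := exists_close_apply hR (Fin k) ks
        (B := Fintype.card ι * (R * B)) (by positivity) hη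
      have hD : 0 < Fintype.card ι * (B + R) + 1 := by positivity
      refine ⟨ρ / (Fintype.card ι * (B + R) + 1), by positivity,
        fun W W' hW hW' hWW x x' hx hxx c => ?_⟩
      have hle : ρ / (Fintype.card ι * (B + R) + 1) ≤ ρ := by
        rw [div_le_iff₀ hD]
        have : 0 ≤ ρ * (Fintype.card ι * (B + R)) := by positivity
        nlinarith
      refine h W.2 W'.2 hW.2 hW'.2 (Close.mono hle ks hWW.2) _ _ (fun u => ?_) (fun u => ?_) c
      · rw [abs_of_nonneg (le_max_left _ _)]
        refine max_le (by positivity) ((le_abs_self _).trans (abs_sum_mul_le (hW.1 u) hx))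
      · rw [max_comm 0, max_comm 0]
        refine (abs_max_sub_max_le_abs _ _ _).trans
          ((abs_sum_mul_sub_sum_mul_le (hW'.1 u) hx (hWW.1 u) hxx).trans ?_)
        rw [mul_left_comm, div_mul_eq_mul_div, div_le_iff₀ hD]
        nlinarith

/-! ### Finite nets -/

theorem exists_finite_net_matrix (m ι : Type) [Fintype m] [Fintype ι] (R : ℝ) {r : ℝ}
    (hr : 0 < r) : ∃ F : Set (m → ι → ℝ), F.Finite ∧ (∀ A ∈ F, ∀ u a, |A u a| ≤ R) ∧
      ∀ A : m → ι → ℝ, (∀ u a, |A u a| ≤ R) → ∃ A' ∈ F, ∀ u a, |A u a - A' u a| ≤ r := by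
  have hc : IsCompact (Set.univ.pi fun _ : m => Set.univ.pi fun _ : ι => Set.Icc (-R) R) :=
    isCompact_univ_pi fun _ => isCompact_univ_pi fun _ => isCompact_Icc
  obtain ⟨F, hF, hfin, hcov⟩ := hc.finite_cover_balls hr
  refine ⟨F, hfin, fun A hA u a => abs_le.2 (hF hA u trivial a trivial), fun A hA => ?_⟩
  have := hcov (show A ∈ _ from fun u _ a _ => abs_le.1 (hA u a))
  simp only [Set.mem_iUnion, Metric.mem_ball] at this
  obtain ⟨A', hA', hd⟩ := this
  refine ⟨A', hA', fun u a => ?_⟩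
  rw [← Real.dist_eq]
  exact ((dist_le_pi_dist (A u) (A' u) a).trans (dist_le_pi_dist A A' u)).trans hd.le

/-- A product of compact intervals is totally bounded. The net points obey the same entry bound, so
the modulus of continuity on that region applies to them. -/
theorem exists_finite_net (R : ℝ) {r : ℝ} (hr : 0 < r) : ∀ (ι : Type) [Fintype ι] (ks : List ℕ),
    ∃ F : Set (Params C ι ks), F.Finite ∧ (∀ W ∈ F, EntriesLE R ks W) ∧
      ∀ W : Params C ι ks, EntriesLE R ks W → ∃ W' ∈ F, Close r ks W W'
  | ι, _, [] => exists_finite_net_matrix (Fin C) ι R hr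
  | ι, _, k :: ks => by
      obtain ⟨F, hF, hFR, hFr⟩ := exists_finite_net_matrix (Fin k) ι R hr
      obtain ⟨G, hG, hGR, hGr⟩ := exists_finite_net R hr (Fin k) ks
      refine ⟨(F ×ˢ G : Set ((Fin k → ι → ℝ) × Params C (Fin k) ks)), hF.prod hG,
        fun W hW => ⟨hFR _ hW.1, hGR _ hW.2⟩, fun W hW => ?_⟩
      obtain ⟨A, hA, h1⟩ := hFr W.1 hW.1
      obtain ⟨V, hV, h2⟩ := hGr W.2 hW.2
      exact ⟨(A, V), ⟨hA, hV⟩, h1, h2⟩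

/-! ### The Gaussian measure of a box -/

instance isProbabilityMeasure_gaussian (v : NNReal) : ∀ {ι : Type} [Fintype ι] (ks : List ℕ),
    IsProbabilityMeasure (gaussian (C := C) v (ι := ι) ks)
  | ι, _, [] => inferInstanceAs (IsProbabilityMeasure
      (Measure.pi fun _ : Fin C => Measure.pi fun _ : ι => gaussianReal 0 v))
  | ι, _, k :: ks => by
      have := isProbabilityMeasure_gaussian v (ι := Fin k) ks
      exact inferInstanceAs (IsProbabilityMeasure (Measure.prod
        (Measure.pi fun _ : Fin k => Measure.pi fun _ : ι => gaussianReal 0 v)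
        (gaussian (C := C) v (ι := Fin k) ks)))

/-- The parameters whose weights differ from those of `W` by at most `r`. -/
def box (r : ℝ) : {ι : Type} → (ks : List ℕ) → Params C ι ks → Set (Params C ι ks)
  | ι, [], W => (Set.univ.pi fun c : Fin C => Set.univ.pi fun a : ι =>
      Set.Icc (W c a - r) (W c a + r))
  | ι, k :: ks, W => (Set.univ.pi fun u : Fin k => Set.univ.pi fun a : ι =>
      Set.Icc (W.1 u a - r) (W.1 u a + r)) ×ˢ box r ks W.2

theorem close_of_mem_box {r : ℝ} : ∀ {ι : Type} (ks : List ℕ) {W W' : Params C ι ks},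
    W' ∈ box r ks W → Close r ks W W'
  | _, [], W, W', h => fun c a => by
      have := h c trivial a trivial
      exact abs_sub_le_iff.2 ⟨by linarith [this.1], by linarith [this.2]⟩
  | _, _ :: ks, W, W', h => ⟨fun u a => by
      have := h.1 u trivial a trivial
      exact abs_sub_le_iff.2 ⟨by linarith [this.1], by linarith [this.2]⟩,
      close_of_mem_box ks h.2⟩

theorem measurableSet_box {r : ℝ} : ∀ {ι : Type} [Fintype ι] (ks : List ℕ) (W : Params C ι ks),
    MeasurableSet (box r ks W)
  | ι, _, [], _ => MeasurableSet.univ_pi (X := fun _ : Fin C => ι → ℝ) fun _ =>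
      MeasurableSet.univ_pi fun _ => measurableSet_Icc
  | _, _, _ :: ks, W => MeasurableSet.prod (MeasurableSet.univ_pi fun _ =>
      MeasurableSet.univ_pi fun _ => measurableSet_Icc) (measurableSet_box ks W.2)

theorem pow_le_pi_pi {m ι : Type} [Fintype m] [Fintype ι] {μ : Measure ℝ} [SigmaFinite μ]
    {p : ENNReal} {s : m → ι → Set ℝ} (h : ∀ u a, p ≤ μ (s u a)) :
    p ^ (Fintype.card m * Fintype.card ι) ≤
      (Measure.pi fun _ : m => Measure.pi fun _ : ι => μ)
        (Set.univ.pi fun u => Set.univ.pi fun a => s u a) := by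
  rw [Measure.pi_pi]
  simp_rw [Measure.pi_pi]
  calc p ^ (Fintype.card m * Fintype.card ι) = ∏ _u : m, ∏ _a : ι, p := by
        simp [pow_mul, pow_right_comm]
    _ ≤ _ := Finset.prod_le_prod' fun u _ => Finset.prod_le_prod' fun a _ => h u a

/-- The measure is a product over the weights; `n` is the number of weights and is independent of
the variance and the radius. -/
theorem exists_pow_le_gaussian_box : ∀ (ι : Type) [Fintype ι] (ks : List ℕ),
    ∃ n : ℕ, ∀ (v : NNReal) (r R : ℝ) (p : ENNReal),
      (∀ x : ℝ, |x| ≤ R → p ≤ gaussianReal 0 v (Set.Icc (x - r) (x + r))) →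
      ∀ W : Params C ι ks, EntriesLE R ks W → p ^ n ≤ gaussian v ks (box r ks W)
  | ι, _, [] => ⟨Fintype.card (Fin C) * Fintype.card ι, fun v r R p h W hW =>
      pow_le_pi_pi fun c a => h _ (hW c a)⟩
  | ι, _, k :: ks => by
      obtain ⟨n, hn⟩ := exists_pow_le_gaussian_box (Fin k) ks
      refine ⟨Fintype.card (Fin k) * Fintype.card ι + n, fun v r R p h W hW => ?_⟩
      have e : gaussian v (k :: ks) (box r (k :: ks) W) =
          (Measure.pi fun _ : Fin k => Measure.pi fun _ : ι => gaussianReal 0 v)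
            (Set.univ.pi fun u : Fin k => Set.univ.pi fun a : ι =>
              Set.Icc (W.1 u a - r) (W.1 u a + r)) * gaussian v ks (box r ks W.2) :=
        Measure.prod_prod _ _
      rw [e, pow_add]
      exact mul_le_mul' (pow_le_pi_pi fun u a => h _ (hW.1 u a)) (hn v r R p h W.2 hW.2)

/-- Interval length times the value of the density at `R + r`, which is its minimum over `[-(R + r),
R + r]`. -/
theorem le_gaussianReal_Icc {v : NNReal} (hv : v ≠ 0) {x r R : ℝ} (hr : 0 ≤ r) (hx : |x| ≤ R) :
    ENNReal.ofReal (2 * r * ((Real.sqrt (2 * Real.pi * v))⁻¹ *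
      Real.exp (-(R + r) ^ 2 / (2 * v)))) ≤ gaussianReal 0 v (Set.Icc (x - r) (x + r)) := by
  rw [gaussianReal_apply _ hv]
  calc _ = ∫⁻ _ in Set.Icc (x - r) (x + r), ENNReal.ofReal ((Real.sqrt (2 * Real.pi * v))⁻¹ *
      Real.exp (-(R + r) ^ 2 / (2 * v))) := by
        rw [setLIntegral_const, Real.volume_Icc, mul_comm (2 * r),
          ENNReal.ofReal_mul (by positivity)]
        congr 2
        ring
    _ ≤ _ := by
        refine setLIntegral_mono (measurable_gaussianPDF _ _) fun y hy => ?_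
        refine ENNReal.ofReal_le_ofReal ?_
        unfold gaussianPDFReal
        have hy' : |y| ≤ R + r := by
          have := abs_le.1 hx
          exact abs_le.2 ⟨by linarith [hy.1], by linarith [hy.2]⟩
        have : (y - 0) ^ 2 ≤ (R + r) ^ 2 := by
          rw [sub_zero]; exact sq_le_sq' (abs_le.1 hy').1 (abs_le.1 hy').2
        gcongr

end Params

/-! ### Margin losses -/

section MarginLoss

variable {C : ℕ}

theorem marginLoss_nonneg (γ : ℝ) (z : Fin C → ℝ) (y : Fin C) : 0 ≤ marginLoss γ z y := by
  unfold marginLoss; split_ifs <;> norm_num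

theorem marginLoss_le_one (γ : ℝ) (z : Fin C → ℝ) (y : Fin C) : marginLoss γ z y ≤ 1 := by
  unfold marginLoss; split_ifs <;> norm_num

/-- The true logit and the best competing logit each move by at most `η`, hence the loss of `2η` in
the margin. Two classes are needed for the supremum to run over a nonempty set. -/
theorem marginLoss_le_marginLoss (hC : 2 ≤ C) {γ γ' η : ℝ} {z z' : Fin C → ℝ}
    (h : ∀ c, |z c - z' c| ≤ η) (hγ : γ + 2 * η ≤ γ') (y : Fin C) :
    marginLoss γ z y ≤ marginLoss γ' z' y := by
  unfold marginLoss
  by_cases h1 : z y ≤ γ + ⨆ c : {c : Fin C // c ≠ y}, z c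
  · have : Nontrivial (Fin C) := Fin.nontrivial_iff_two_le.2 hC
    obtain ⟨c₀, hc₀⟩ := exists_ne y
    have : Nonempty {c : Fin C // c ≠ y} := ⟨⟨c₀, hc₀⟩⟩
    have h2 : (⨆ c : {c : Fin C // c ≠ y}, z c) ≤ (⨆ c : {c : Fin C // c ≠ y}, z' c) + η :=
      ciSup_le fun c => by
        have h3 := le_ciSup (f := fun c : {c : Fin C // c ≠ y} => z' c)
          (Set.finite_range _).bddAbove c
        have := abs_le.1 (h c)
        linarith
    have h4 := abs_le.1 (h y)
    rw [if_pos h1, if_pos (by linarith)]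
  · rw [if_neg h1]
    split_ifs <;> norm_num

end MarginLoss

/-! ### Stability of empirical losses and logits -/

theorem empLoss_le_empLoss {d C : ℕ} (hC : 2 ≤ C) (E : Environment d C) (ks : List ℕ)
    {γ γ' η : ℝ} {W W' : Params C (Fin d ⊕ Fin d) ks}
    (h : ∀ i c, |logits E ks W i c - logits E ks W' i c| ≤ η) (hγ : γ + 2 * η ≤ γ')
    (y : E.V → Fin C) : empLoss E ks γ W y ≤ empLoss E ks γ' W' y := by
  unfold empLoss
  gcongr with i
  exact marginLoss_le_marginLoss hC (h i) hγ _

theorem abs_logits_sub_logits_le {d C : ℕ} (E E' : Environment d C) (ks : List ℕ)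
    (W : Params C (Fin d ⊕ Fin d) ks) (i : E.V) (j : E'.V) (c : Fin C) :
    |logits E ks W i c - logits E' ks W j c| ≤
      Params.maxSpecNorm ks W ^ depth ks * ‖E.agg i - E'.agg j‖ :=
  (abs_apply_le_norm_toLp (fun c => logits E ks W i c - logits E' ks W j c) c).trans
    (Params.norm_apply_sub_apply_le ks W le_rfl _ _)

/-! ### The law of the labels -/

namespace CSBM

variable {d C : ℕ} {σ : ℝ}

theorem density_pos (hσ : 0 < σ) (M : CSBM d C σ) (E : Environment d C) (i : E.V) (c : Fin C)
    (z : Feat d) : 0 < M.density E i c z := by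
  unfold density
  positivity

theorem posterior_nonneg (hσ : 0 < σ) (M : CSBM d C σ) (E : Environment d C) (i : E.V)
    (c : Fin C) : 0 ≤ M.posterior E i c := by
  unfold posterior
  exact div_nonneg (mul_nonneg (by positivity) (density_pos hσ M E i c _).le)
    (Finset.sum_nonneg fun c' _ => mul_nonneg (by positivity) (density_pos hσ M E i c' _).le)

theorem weight_pos (hC : 0 < C) (hσ : 0 < σ) (M : CSBM d C σ) (E : Environment d C) (i : E.V)
    (c : Fin C) : 0 < (C : ℝ)⁻¹ * M.density E i c (E.agg i) :=
  mul_pos (by positivity) (density_pos hσ M E i c _)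

theorem sum_weight_pos (hC : 0 < C) (hσ : 0 < σ) (M : CSBM d C σ) (E : Environment d C)
    (i : E.V) : 0 < ∑ c, (C : ℝ)⁻¹ * M.density E i c (E.agg i) :=
  Finset.sum_pos (fun c _ => weight_pos hC hσ M E i c) ⟨⟨0, hC⟩, Finset.mem_univ _⟩

theorem sum_posterior (hC : 0 < C) (hσ : 0 < σ) (M : CSBM d C σ) (E : Environment d C)
    (i : E.V) : ∑ c, M.posterior E i c = 1 := by
  unfold posterior
  rw [← Finset.sum_div]
  exact div_self (sum_weight_pos hC hσ M E i).ne'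

theorem isProbabilityMeasure_nodeLabelLaw (hC : 0 < C) (hσ : 0 < σ) (M : CSBM d C σ)
    (E : Environment d C) (i : E.V) : IsProbabilityMeasure (M.nodeLabelLaw E i) := by
  constructor
  unfold nodeLabelLaw
  simp only [Measure.coe_finsetSum, Measure.coe_smul, Finset.sum_apply, Pi.smul_apply,
    measure_univ, smul_eq_mul, mul_one]
  rw [← ENNReal.ofReal_sum_of_nonneg fun c _ => posterior_nonneg hσ M E i c,
    sum_posterior hC hσ, ENNReal.ofReal_one]

theorem integral_nodeLabelLaw (hσ : 0 < σ) (M : CSBM d C σ)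
    (E : Environment d C) (i : E.V) (f : Fin C → ℝ) :
    ∫ c, f c ∂(M.nodeLabelLaw E i) = ∑ c, M.posterior E i c * f c := by
  unfold nodeLabelLaw
  rw [integral_finsetSum_measure fun c _ =>
    Integrable.of_finite.smul_measure ENNReal.ofReal_ne_top]
  refine Finset.sum_congr rfl fun c _ => ?_
  rw [integral_smul_measure, integral_dirac, ENNReal.toReal_ofReal (posterior_nonneg hσ M E i c),
    smul_eq_mul]

/-- The loss is a sum of functions of single labels, so only the marginal laws enter. -/
theorem expLoss_eq (hC : 0 < C) (hσ : 0 < σ) (M : CSBM d C σ) (E : Environment d C)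
    (ks : List ℕ) (γ : ℝ) (W : Params C (Fin d ⊕ Fin d) ks) :
    M.expLoss E ks γ W = (1 / (E.size : ℝ)) *
      ∑ i, ∑ c, M.posterior E i c * marginLoss γ (logits E ks W i) c := by
  have := isProbabilityMeasure_nodeLabelLaw hC hσ M E
  unfold expLoss empLoss labelLaw
  rw [integral_const_mul, integral_finsetSum _ fun i _ => Integrable.of_finite]
  congr 1
  refine Finset.sum_congr rfl fun i _ => ?_
  rw [integral_comp_eval (μ := fun i => M.nodeLabelLaw E i)
    (f := fun c => marginLoss γ (logits E ks W i) c) (by fun_prop),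
    integral_nodeLabelLaw hσ]

theorem expLoss_le_expLoss (hC : 2 ≤ C) (hσ : 0 < σ) (M : CSBM d C σ) (E : Environment d C)
    (ks : List ℕ) {γ γ' η : ℝ} {W W' : Params C (Fin d ⊕ Fin d) ks}
    (h : ∀ i c, |logits E ks W i c - logits E ks W' i c| ≤ η) (hγ : γ + 2 * η ≤ γ') :
    M.expLoss E ks γ W ≤ M.expLoss E ks γ' W' := by
  have := isProbabilityMeasure_nodeLabelLaw (by omega) hσ M E
  unfold expLoss labelLaw
  exact integral_mono Integrable.of_finite Integrable.of_finite
    fun y => empLoss_le_empLoss hC E ks h hγ y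

/-! ### Comparison of posteriors -/

/-- Numerator and normalizer each cost a factor `exp t`, and `1 - exp (-2t) ≤ 2t`. The bound is kept
proportional to the weight of `c`, so that its sum over the classes is `2t` without a factor of
their number. -/
theorem div_sum_sub_div_sum_le {ι : Type*} [Fintype ι] {w w' : ι → ℝ} {t : ℝ}
    (hw : ∀ c, 0 < w c) (hw' : ∀ c, 0 < w' c) (h : ∀ c, w c ≤ Real.exp t * w' c)
    (h' : ∀ c, w' c ≤ Real.exp t * w c) (c : ι) :
    w c / ∑ b, w b - w' c / ∑ b, w' b ≤ 2 * t * (w c / ∑ b, w b) := by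
  have hS : 0 < ∑ b, w b := Finset.sum_pos (fun b _ => hw b) ⟨c, Finset.mem_univ _⟩
  have hS' : 0 < ∑ b, w' b := Finset.sum_pos (fun b _ => hw' b) ⟨c, Finset.mem_univ _⟩
  have h1 : ∑ b, w' b ≤ Real.exp t * ∑ b, w b := by
    rw [Finset.mul_sum]
    exact Finset.sum_le_sum fun b _ => h' b
  have h2 : Real.exp (-(2 * t)) * (w c / ∑ b, w b) ≤ w' c / ∑ b, w' b := by
    rw [le_div_iff₀ hS', mul_assoc]
    calc Real.exp (-(2 * t)) * ((w c / ∑ b, w b) * ∑ b, w' b)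
        ≤ Real.exp (-(2 * t)) * ((Real.exp t * w' c) / (∑ b, w b) * (Real.exp t * ∑ b, w b)) := by
          have := (hw' c).le
          have := (hw c).le
          gcongr
          exact h c
      _ = (Real.exp (-(2 * t)) * Real.exp t * Real.exp t) * w' c := by
          field_simp
      _ = w' c := by
          rw [← Real.exp_add, ← Real.exp_add, show -(2 * t) + t + t = 0 by ring, Real.exp_zero,
            one_mul]
  have h3 := Real.add_one_le_exp (-(2 * t))
  have h4 : 0 ≤ w c / ∑ b, w b := by have := hw c; positivity
  nlinarith

theorem norm_concat_le (u v : EuclideanSpace ℝ (Fin d)) : ‖concat u v‖ ≤ ‖u‖ + ‖v‖ := by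
  have h : ‖concat u v‖ ^ 2 = ‖u‖ ^ 2 + ‖v‖ ^ 2 := by
    simp [EuclideanSpace.norm_sq_eq, concat]
  refine abs_le_of_sq_le_sq' ?_ (by positivity) |>.2
  rw [h]
  nlinarith [norm_nonneg u, norm_nonneg v]

theorem norm_featMean_le (M : CSBM d C σ) (E : Environment d C) (c : Fin C) :
    ‖M.featMean E c‖ ≤ 2 := by
  refine (norm_concat_le _ _).trans ?_
  rw [M.orthonormal_mu.1, E.orthonormal_muSp.1]
  norm_num

theorem norm_featMean_sub_le (M : CSBM d C σ) (E E' : Environment d C) (c : Fin C) :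
    ‖M.featMean E c - M.featMean E' c‖ ≤ ‖E.muSp c - E'.muSp c‖ := by
  have h : M.featMean E c - M.featMean E' c = concat 0 (E.muSp c - E'.muSp c) := by
    ext k
    rcases k with k | k <;> simp [featMean, concat]
  rw [h]
  simpa using norm_concat_le 0 (E.muSp c - E'.muSp c)

theorem norm_aggMean_le (M : CSBM d C σ) (E : Environment d C) (i : E.V) (c : Fin C) :
    ‖M.aggMean E i c‖ ≤ 2 := by
  unfold aggMean
  calc _ ≤ E.pHm i * 2 + ∑ c' ∈ Finset.univ.filter (fun c' => c' ≠ c), E.pHt i c c' * 2 := by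
        refine (norm_add_le _ _).trans (add_le_add ?_ ((norm_sum_le _ _).trans
          (Finset.sum_le_sum fun c' hc' => ?_)))
        · rw [norm_smul, Real.norm_of_nonneg (E.pHm_nonneg i)]
          exact mul_le_mul_of_nonneg_left (norm_featMean_le M E c) (E.pHm_nonneg i)
        · have h := E.pHt_nonneg i c c' (Finset.mem_filter.1 hc').2
          rw [norm_smul, Real.norm_of_nonneg h]
          exact mul_le_mul_of_nonneg_left (norm_featMean_le M E c') h
    _ = 2 := by rw [← Finset.sum_mul, ← add_mul, E.sum_ratio, one_mul]

theorem norm_smul_sub_smul_le {V : Type*} [NormedAddCommGroup V] [NormedSpace ℝ V] {a b : ℝ}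
    (hb : 0 ≤ b) (u v : V) : ‖a • u - b • v‖ ≤ |a - b| * ‖u‖ + b * ‖u - v‖ := by
  have h : a • u - b • v = (a - b) • u + b • (u - v) := by
    rw [sub_smul, smul_sub]; abel
  rw [h]
  refine (norm_add_le _ _).trans_eq ?_
  rw [norm_smul, norm_smul, Real.norm_of_nonneg hb, Real.norm_eq_abs]

/-- The ratios sum to one, so the change of the homophilic ratio is at most the total change of the
heterophilic ones. This doubles the ratio term, and the bound `2` on feature means turns it into
`4`. -/
theorem norm_aggMean_sub_le (M : CSBM d C σ) (E E' : Environment d C) (i : E.V) (j : E'.V)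
    (c : Fin C) : ‖M.aggMean E i c - M.aggMean E' j c‖ ≤ (∑ c', ‖E.muSp c' - E'.muSp c'‖) +
      4 * ∑ c' ∈ Finset.univ.filter (fun c' => c' ≠ c), |E.pHt i c c' - E'.pHt j c c'| := by
  set S := ∑ c', ‖E.muSp c' - E'.muSp c'‖ with hS
  have hfeat : ∀ c', ‖M.featMean E c' - M.featMean E' c'‖ ≤ S := fun c' =>
    (norm_featMean_sub_le M E E' c').trans (Finset.single_le_sum
      (f := fun c' => ‖E.muSp c' - E'.muSp c'‖) (fun _ _ => norm_nonneg _) (Finset.mem_univ c'))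
  have hterm : ∀ (a b : ℝ), 0 ≤ b → ∀ c', ‖a • M.featMean E c' - b • M.featMean E' c'‖ ≤
      |a - b| * 2 + b * S := fun a b hb c' =>
    (norm_smul_sub_smul_le hb _ _).trans (add_le_add
      (mul_le_mul_of_nonneg_left (norm_featMean_le M E c') (abs_nonneg _))
      (mul_le_mul_of_nonneg_left (hfeat c') hb))
  have hhm : |E.pHm i - E'.pHm j| ≤
      ∑ c' ∈ Finset.univ.filter (fun c' => c' ≠ c), |E.pHt i c c' - E'.pHt j c c'| := by
    have h1 := E.sum_ratio i c
    have h2 := E'.sum_ratio j c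
    have h3 : E.pHm i - E'.pHm j =
        -∑ c' ∈ Finset.univ.filter (fun c' => c' ≠ c), (E.pHt i c c' - E'.pHt j c c') := by
      rw [Finset.sum_sub_distrib]; linarith
    rw [h3, abs_neg]
    exact Finset.abs_sum_le_sum_abs _ _
  have hsplit : M.aggMean E i c - M.aggMean E' j c =
      (E.pHm i • M.featMean E c - E'.pHm j • M.featMean E' c) +
      ∑ c' ∈ Finset.univ.filter (fun c' => c' ≠ c),
        (E.pHt i c c' • M.featMean E c' - E'.pHt j c c' • M.featMean E' c') := by
    rw [Finset.sum_sub_distrib]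
    unfold aggMean
    abel
  rw [hsplit]
  calc _ ≤ (|E.pHm i - E'.pHm j| * 2 + E'.pHm j * S) +
      ∑ c' ∈ Finset.univ.filter (fun c' => c' ≠ c),
        (|E.pHt i c c' - E'.pHt j c c'| * 2 + E'.pHt j c c' * S) := by
        refine (norm_add_le _ _).trans (add_le_add (hterm _ _ (E'.pHm_nonneg j) c)
          ((norm_sum_le _ _).trans (Finset.sum_le_sum fun c' hc' => ?_)))
        exact hterm _ _ (E'.pHt_nonneg j c c' (Finset.mem_filter.1 hc').2) c'
    _ = |E.pHm i - E'.pHm j| * 2 + (E'.pHm j +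
        ∑ c' ∈ Finset.univ.filter (fun c' => c' ≠ c), E'.pHt j c c') * S +
        (∑ c' ∈ Finset.univ.filter (fun c' => c' ≠ c), |E.pHt i c c' - E'.pHt j c c'|) * 2 := by
        rw [Finset.sum_add_distrib, ← Finset.sum_mul, ← Finset.sum_mul]; ring
    _ ≤ _ := by rw [E'.sum_ratio]; linarith

theorem abs_sq_norm_sub_sq_norm_le {V : Type*} [NormedAddCommGroup V] {u v : V} {r : ℝ}
    (hu : ‖u‖ ≤ r) (hv : ‖v‖ ≤ r) : |‖u‖ ^ 2 - ‖v‖ ^ 2| ≤ ‖u - v‖ * (2 * r) := by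
  rw [sq_sub_sq, mul_comm, abs_mul]
  refine mul_le_mul (abs_norm_sub_norm_le u v) ?_ (abs_nonneg _) (norm_nonneg _)
  rw [abs_of_nonneg (by positivity)]
  linarith

/-- A bound of the difference of the log-densities of the aggregated features of two nodes. -/
def logDensityGap (M : CSBM d C σ) (E E' : Environment d C) (B ε : ℝ) (i : E.V) (j : E'.V) : ℝ :=
  (B + 2) / σ ^ 2 * (ε + (∑ c, ‖E.muSp c - E'.muSp c‖) +
    4 * ∑ c, ∑ c' ∈ Finset.univ.filter (fun c' => c' ≠ c), |E.pHt i c c' - E'.pHt j c c'|)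

/-- The normalizing constants coincide, so only a difference of squared norms matters; both vectors
have norm at most `B + 2`. -/
theorem density_le_exp_mul_density (hσ : 0 < σ) (M : CSBM d C σ) (E E' : Environment d C)
    {B ε : ℝ} {i : E.V} {j : E'.V} (hi : ‖E.agg i‖ ≤ B) (hj : ‖E'.agg j‖ ≤ B)
    (hij : ‖E.agg i - E'.agg j‖ ≤ ε) (c : Fin C) :
    M.density E i c (E.agg i) ≤
        Real.exp (M.logDensityGap E E' B ε i j) * M.density E' j c (E'.agg j) ∧
      M.density E' j c (E'.agg j) ≤
        Real.exp (M.logDensityGap E E' B ε i j) * M.density E i c (E.agg i) := by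
  set u := E.agg i - M.aggMean E i c with hu
  set v := E'.agg j - M.aggMean E' j c with hv
  have hB : 0 ≤ B := (norm_nonneg _).trans hi
  have hun : ‖u‖ ≤ B + 2 := (norm_sub_le _ _).trans (add_le_add hi (norm_aggMean_le M E i c))
  have hvn : ‖v‖ ≤ B + 2 := (norm_sub_le _ _).trans (add_le_add hj (norm_aggMean_le M E' j c))
  have huv : ‖u - v‖ ≤ ε + (∑ c, ‖E.muSp c - E'.muSp c‖) +
      4 * ∑ c, ∑ c' ∈ Finset.univ.filter (fun c' => c' ≠ c),
        |E.pHt i c c' - E'.pHt j c c'| := by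
    have h1 : u - v = (E.agg i - E'.agg j) - (M.aggMean E i c - M.aggMean E' j c) := by
      rw [hu, hv]; abel
    have h2 := norm_aggMean_sub_le M E E' i j c
    have h3 := Finset.single_le_sum (f := fun c => ∑ c' ∈ Finset.univ.filter (fun c' => c' ≠ c),
      |E.pHt i c c' - E'.pHt j c c'|) (fun _ _ => Finset.sum_nonneg fun _ _ => abs_nonneg _)
      (Finset.mem_univ c)
    rw [h1]
    refine (norm_sub_le _ _).trans ?_
    linarith
  have hgap : |‖u‖ ^ 2 - ‖v‖ ^ 2| / (2 * σ ^ 2) ≤ M.logDensityGap E E' B ε i j := by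
    rw [div_le_iff₀ (by positivity)]
    refine (abs_sq_norm_sub_sq_norm_le hun hvn).trans
      ((mul_le_mul_of_nonneg_right huv (by positivity)).trans_eq ?_)
    unfold logDensityGap
    field_simp
  have hexp : ∀ a b : ℝ, |a - b| / (2 * σ ^ 2) ≤ M.logDensityGap E E' B ε i j →
      Real.exp (-(a / (2 * σ ^ 2))) ≤ Real.exp (M.logDensityGap E E' B ε i j) *
        Real.exp (-(b / (2 * σ ^ 2))) := fun a b hab => by
    rw [← Real.exp_add]
    refine Real.exp_le_exp.2 ?_
    have : (b - a) / (2 * σ ^ 2) ≤ |a - b| / (2 * σ ^ 2) := by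
      gcongr
      rw [abs_sub_comm]
      exact le_abs_self _
    rw [sub_div] at this
    linarith
  unfold density
  constructor
  · rw [mul_left_comm]
    exact mul_le_mul_of_nonneg_left (hexp _ _ hgap) (by positivity)
  · rw [mul_left_comm]
    exact mul_le_mul_of_nonneg_left (hexp _ _ (by rwa [abs_sub_comm])) (by positivity)

theorem posterior_sub_posterior_le (hC : 0 < C) (hσ : 0 < σ) (M : CSBM d C σ)
    (E E' : Environment d C) {B ε : ℝ} {i : E.V} {j : E'.V} (hi : ‖E.agg i‖ ≤ B)
    (hj : ‖E'.agg j‖ ≤ B) (hij : ‖E.agg i - E'.agg j‖ ≤ ε) (c : Fin C) :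
    M.posterior E i c - M.posterior E' j c ≤
      2 * M.logDensityGap E E' B ε i j * M.posterior E i c := by
  have h := density_le_exp_mul_density hσ M E E' hi hj hij
  refine div_sum_sub_div_sum_le (weight_pos hC hσ M E i) (weight_pos hC hσ M E' j)
    (fun c => ?_) (fun c => ?_) c <;> rw [mul_left_comm]
  · exact mul_le_mul_of_nonneg_left (h c).1 (by positivity)
  · exact mul_le_mul_of_nonneg_left (h c).2 (by positivity)

/-! ### Near sets -/

theorem size_pos (E : Environment d C) : (0 : ℝ) < E.size := by
  exact_mod_cast (Fintype.card_pos : 0 < Fintype.card E.V)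

theorem norm_agg_train_le (M : CSBM d C σ) (e : M.Test) (i : M.train.V) :
    ‖M.train.agg i‖ ≤ M.maxNorm e :=
  (le_ciSup (f := fun i => ‖M.train.agg i‖) (Set.finite_range _).bddAbove i).trans
    (le_max_left _ _)

theorem norm_agg_test_le (M : CSBM d C σ) (e : M.Test) (j : (M.test e).V) :
    ‖(M.test e).agg j‖ ≤ M.maxNorm e :=
  (le_ciSup (f := fun j => ‖(M.test e).agg j‖) (Set.finite_range _).bddAbove j).trans
    (le_max_right _ _)

theorem dist_nonneg (M : CSBM d C σ) (e : M.Test) : 0 ≤ M.dist e :=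
  Real.iSup_nonneg fun _ => Real.iInf_nonneg fun _ => norm_nonneg _

theorem dist_le (M : CSBM d C σ) (e : M.Test) : M.dist e ≤ 2 * M.maxNorm e := by
  refine ciSup_le fun j => ?_
  obtain ⟨i⟩ := M.train.nonemptyV
  refine (ciInf_le (Set.finite_range _).bddBelow i).trans ((norm_sub_le _ _).trans ?_)
  linarith [norm_agg_train_le M e i, norm_agg_test_le M e j]

theorem mem_near {M : CSBM d C σ} {e : M.Test} {i : M.train.V} {j : (M.test e).V} :
    j ∈ M.near e i ↔ ‖M.train.agg i - (M.test e).agg j‖ ≤ M.dist e := by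
  simp [near]

theorem exists_mem_near (M : CSBM d C σ) (e : M.Test) (j : (M.test e).V) :
    ∃ i, j ∈ M.near e i := by
  obtain ⟨i, hi⟩ := exists_eq_ciInf_of_finite
    (f := fun i : M.train.V => ‖M.train.agg i - (M.test e).agg j‖)
  refine ⟨i, mem_near.2 ?_⟩
  rw [hi]
  exact le_ciSup (f := fun j : (M.test e).V => ⨅ i : M.train.V,
    ‖M.train.agg i - (M.test e).agg j‖) (Set.finite_range _).bddAbove j

/-- The near sets are disjoint by assumption, and they cover the test nodes because `ε` is the
largest distance from a test node to its nearest training node. -/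
theorem NearSets.sum_eq {M : CSBM d C σ} {e : M.Test} {s : ℕ} (h : M.NearSets e s)
    (f : (M.test e).V → ℝ) : ∑ j, f j = ∑ i, ∑ j ∈ M.near e i, f j := by
  classical
  rw [← Finset.sum_biUnion fun i _ i' _ hii => h.2.2 i i' hii]
  refine Finset.sum_congr ?_ fun _ _ => rfl
  ext j
  simpa using exists_mem_near M e j

theorem NearSets.size_test {M : CSBM d C σ} {e : M.Test} {s : ℕ} (h : M.NearSets e s) :
    ((M.test e).size : ℝ) = M.train.size * s := by
  have := h.sum_eq fun _ => 1
  simpa [h.2.1, Environment.size] using this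

/-! ### The terms of the bound -/

/-- A single ordered pair of distinct classes contributes at least `2√2 ≥ 2`. -/
theorem two_mul_dist_le_termA (hC : 2 ≤ C) (hσ : 0 < σ) (M : CSBM d C σ) (e : M.Test) :
    2 / σ ^ 2 * M.dist e ≤ M.termA e := by
  have : Nontrivial (Fin C) := Fin.nontrivial_iff_two_le.2 hC
  have h2 : (2 : ℝ) ≤ 2 * Real.sqrt 2 := by
    have : (1 : ℝ) ≤ Real.sqrt 2 := by rw [Real.one_le_sqrt]; norm_num
    linarith
  have c₀ : Fin C := ⟨0, by omega⟩
  obtain ⟨c₁, hc₁⟩ := exists_ne c₀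
  have h1 : (2 : ℝ) ≤ ∑ c : Fin C, ∑ c' ∈ Finset.univ.filter (fun c' => c' ≠ c),
      (Real.sqrt ‖concat (M.mu c - M.mu c') ((M.test e).muSp c - (M.test e).muSp c')‖ +
        2 * Real.sqrt 2) := by
    refine le_trans ?_ (Finset.single_le_sum
      (fun c _ => Finset.sum_nonneg fun c' _ => by positivity) (Finset.mem_univ c₀))
    refine le_trans ?_ (Finset.single_le_sum (fun c _ => by positivity)
      (Finset.mem_filter.2 ⟨Finset.mem_univ c₁, hc₁⟩))
    linarith [Real.sqrt_nonneg
      ‖concat (M.mu c₀ - M.mu c₁) ((M.test e).muSp c₀ - (M.test e).muSp c₁)‖]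
  have := dist_nonneg M e
  unfold termA
  calc 2 / σ ^ 2 * M.dist e = 1 / σ ^ 2 * (2 * M.dist e) := by ring
    _ ≤ _ := by gcongr

theorem two_mul_sum_le_termB (hC : 2 ≤ C) (M : CSBM d C σ) (e : M.Test)
    (hB : 0 ≤ M.maxNorm e) :
    2 * M.maxNorm e / σ ^ 2 * ∑ c, ‖(M.test e).muSp c - M.train.muSp c‖ ≤ M.termB e := by
  have hC' : (2 : ℝ) ≤ C := by exact_mod_cast hC
  unfold termB
  calc _ = 1 / σ ^ 2 * (2 * ∑ c, M.maxNorm e * ‖(M.test e).muSp c - M.train.muSp c‖) := by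
        rw [← Finset.mul_sum]; ring
    _ ≤ _ := by
        gcongr with c
        nlinarith

theorem termC_nonneg (M : CSBM d C σ) (e : M.Test) (s : ℕ) : 0 ≤ M.termC e s := by
  unfold termC
  positivity

theorem termA_nonneg (M : CSBM d C σ) (e : M.Test) : 0 ≤ M.termA e := by
  have := dist_nonneg M e
  unfold termA
  positivity

theorem termB_nonneg (hC : 2 ≤ C) (M : CSBM d C σ) (e : M.Test)
    (hB : 0 ≤ M.maxNorm e) : 0 ≤ M.termB e :=
  le_trans (by positivity) (two_mul_sum_le_termB hC M e hB)

/-! ### The loss discrepancy of a single perceptron -/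

theorem sum_posterior_mul_marginLoss_le (hC : 2 ≤ C) (hσ : 0 < σ) (M : CSBM d C σ)
    (E E' : Environment d C) (ks : List ℕ) {γ γ' η B ε : ℝ} {W : Params C (Fin d ⊕ Fin d) ks}
    {i : E.V} {j : E'.V} (hi : ‖E.agg i‖ ≤ B) (hj : ‖E'.agg j‖ ≤ B)
    (hij : ‖E.agg i - E'.agg j‖ ≤ ε) (hB : 0 ≤ B) (hW : Params.maxSpecNorm ks W ^ depth ks * ε ≤ η)
    (hγ : γ + 2 * η ≤ γ') :
    ∑ c, M.posterior E i c * marginLoss γ (logits E ks W i) c ≤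
      ∑ c, M.posterior E' j c * marginLoss γ' (logits E' ks W j) c +
        2 * M.logDensityGap E E' B ε i j := by
  have hε : 0 ≤ ε := (norm_nonneg _).trans hij
  have hgap : 0 ≤ M.logDensityGap E E' B ε i j := by
    unfold logDensityGap
    positivity
  have hT : 0 ≤ Params.maxSpecNorm ks W ^ depth ks := pow_nonneg (Params.maxSpecNorm_nonneg _ _) _
  have hsum : 2 * M.logDensityGap E E' B ε i j =
      ∑ c, 2 * M.logDensityGap E E' B ε i j * M.posterior E i c := by
    rw [← Finset.mul_sum, sum_posterior (by omega) hσ, mul_one]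
  rw [hsum, ← Finset.sum_add_distrib]
  refine Finset.sum_le_sum fun c _ => ?_
  have h1 : marginLoss γ (logits E ks W i) c ≤ marginLoss γ' (logits E' ks W j) c :=
    marginLoss_le_marginLoss hC (fun c => (abs_logits_sub_logits_le E E' ks W i j c).trans
      ((mul_le_mul_of_nonneg_left hij hT).trans hW)) hγ c
  have h2 := posterior_sub_posterior_le (by omega) hσ M E E' hi hj hij c
  have h3 := posterior_nonneg hσ M E i c
  have h4 := marginLoss_nonneg γ' (logits E' ks W j) c
  have h5 := marginLoss_le_one γ' (logits E' ks W j) c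
  have h6 := mul_nonneg hgap h3
  -- With posteriors `p`, `p'` and losses `m ≤ m'`: `p m ≤ p m' = p' m' + (p - p') m'`, and the last
  -- product is at most the posterior gap since `0 ≤ m' ≤ 1`.
  nlinarith [mul_le_mul_of_nonneg_left h1 h3, mul_le_mul_of_nonneg_right h2 h4,
    mul_le_mul_of_nonneg_left h5 h6]

theorem expLoss_test_le (hC : 2 ≤ C) (hσ : 0 < σ) (M : CSBM d C σ) (e : M.Test) {s : ℕ}
    (hB : 0 < M.maxNorm e) (hs : M.NearSets e s) (ks : List ℕ) {γ γ' η : ℝ}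
    {W : Params C (Fin d ⊕ Fin d) ks}
    (hW : Params.maxSpecNorm ks W ^ depth ks * M.dist e ≤ η) (hγ : γ + 2 * η ≤ γ') :
    M.expLoss (M.test e) ks γ W ≤ M.expLoss M.train ks γ' W +
      (16 * (M.maxNorm e + 2) + (M.maxNorm e + 2) / M.maxNorm e) *
        (M.termA e + M.termB e + M.termC e s) := by
  set B := M.maxNorm e with hBdef
  set ε := M.dist e with hε
  set N : ℝ := (M.train.size : ℝ) with hN
  have hNpos : 0 < N := size_pos _
  have hspos : (0 : ℝ) < s := by exact_mod_cast hs.1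
  set S := ∑ c, ‖(M.test e).muSp c - M.train.muSp c‖ with hS
  set q : M.train.V → (M.test e).V → ℝ := fun i j =>
    ∑ c, ∑ c' ∈ Finset.univ.filter (fun c' => c' ≠ c),
      |(M.test e).pHt j c c' - M.train.pHt i c c'| with hq
  set l : M.train.V → ℝ := fun i =>
    ∑ c, M.posterior M.train i c * marginLoss γ' (logits M.train ks W i) c with hl
  have hkey : M.expLoss (M.test e) ks γ W ≤ 1 / (N * s) * ∑ i, ∑ j ∈ M.near e i,
      (l i + 2 * ((B + 2) / σ ^ 2 * (ε + S + 4 * q i j))) := by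
    rw [expLoss_eq (by omega) hσ, hs.size_test, hs.sum_eq]
    refine mul_le_mul_of_nonneg_left (Finset.sum_le_sum fun i _ => Finset.sum_le_sum
      fun j hj => ?_) (by positivity)
    refine sum_posterior_mul_marginLoss_le hC hσ M (M.test e) M.train ks
      (norm_agg_test_le M e j) (norm_agg_train_le M e i) ?_ hB.le hW hγ
    rw [norm_sub_rev]
    exact mem_near.1 hj
  have hsumq : 1 / (N * s) * ∑ i, ∑ j ∈ M.near e i,
      (l i + 2 * ((B + 2) / σ ^ 2 * (ε + S + 4 * q i j))) =
      1 / N * ∑ i, l i + 2 * (B + 2) / σ ^ 2 * (ε + S) +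
        8 * (B + 2) / σ ^ 2 * ((1 / N) * ∑ i, (1 / (s : ℝ)) * ∑ j ∈ M.near e i, q i j) := by
    have h1 : ∀ i, ∑ j ∈ M.near e i, (l i + 2 * ((B + 2) / σ ^ 2 * (ε + S + 4 * q i j))) =
        s * (l i + 2 * (B + 2) / σ ^ 2 * (ε + S)) +
          8 * (B + 2) / σ ^ 2 * ∑ j ∈ M.near e i, q i j := fun i => by
      rw [Finset.mul_sum, ← hs.2.1 i, ← nsmul_eq_mul, ← Finset.sum_const,
        ← Finset.sum_add_distrib]
      refine Finset.sum_congr rfl fun j _ => ?_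
      ring
    simp_rw [h1]
    rw [Finset.sum_add_distrib, ← Finset.mul_sum, ← Finset.mul_sum, ← Finset.mul_sum,
      Finset.sum_add_distrib, Finset.sum_const, Finset.card_univ, nsmul_eq_mul]
    have : (Fintype.card M.train.V : ℝ) = N := rfl
    rw [this]
    field_simp
  have hA := two_mul_dist_le_termA hC hσ M e
  have hBt := two_mul_sum_le_termB hC M e hB.le
  have hCt : M.termC e s =
      1 / (2 * σ ^ 2) * ((1 / N) * ∑ i, (1 / (s : ℝ)) * ∑ j ∈ M.near e i, q i j) := rfl
  have hA0 := termA_nonneg M e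
  have hB0 := termB_nonneg hC M e hB.le
  have hC0 := termC_nonneg M e s
  rw [expLoss_eq (by omega) hσ M M.train]
  refine hkey.trans (hsumq.trans_le ?_)
  -- The three contributions are matched to the normalizations of (a), (b), (c); this produces the
  -- factors `B + 2`, `(B + 2) / B` and `16 (B + 2)`.
  have e1 : 2 * (B + 2) / σ ^ 2 * (ε + S) + 8 * (B + 2) / σ ^ 2 *
      ((1 / N) * ∑ i, (1 / (s : ℝ)) * ∑ j ∈ M.near e i, q i j) =
      (B + 2) * (2 / σ ^ 2 * ε) + (B + 2) / B * (2 * B / σ ^ 2 * S) +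
        16 * (B + 2) * M.termC e s := by
    rw [hCt]
    field_simp
    ring
  have h1 := mul_le_mul_of_nonneg_left hA (by positivity : 0 ≤ B + 2)
  have h2 := mul_le_mul_of_nonneg_left hBt (by positivity : 0 ≤ (B + 2) / B)
  have h3 : 0 ≤ (B + 2) / B := by positivity
  have h4 : 0 ≤ B + 2 := by positivity
  nlinarith [mul_nonneg h3 hA0, mul_nonneg h3 hC0, mul_nonneg h4 hA0, mul_nonneg h4 hB0]

theorem discrepancy_le (hC : 2 ≤ C) (hσ : 0 < σ) (M : CSBM d C σ) (e : M.Test) {s : ℕ}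
    (hB : 0 < M.maxNorm e) (hs : M.NearSets e s) (ks : List ℕ) {γ lam : ℝ} (hlam : 0 < lam)
    {P : Measure (Params C (Fin d ⊕ Fin d) ks)} [IsProbabilityMeasure P]
    (hP : ∀ᵐ W ∂P, Params.maxSpecNorm ks W ^ depth ks * M.dist e ≤ γ / 8) :
    M.discrepancy e ks (γ / 2) lam P ≤
      lam * ((16 * (M.maxNorm e + 2) + (M.maxNorm e + 2) / M.maxNorm e) *
        (M.termA e + M.termB e + M.termC e s)) := by
  set K := (16 * (M.maxNorm e + 2) + (M.maxNorm e + 2) / M.maxNorm e) *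
    (M.termA e + M.termB e + M.termC e s) with hK
  have hK0 : 0 ≤ K := by
    have := termA_nonneg M e
    have := termB_nonneg hC M e hB.le
    have := termC_nonneg M e s
    positivity
  have hle : ∫ W, Real.exp (lam * (M.expLoss (M.test e) ks (γ / 2 / 2) W -
      M.expLoss M.train ks (γ / 2) W)) ∂P ≤ Real.exp (lam * K) := by
    by_cases hint : Integrable (fun W => Real.exp (lam * (M.expLoss (M.test e) ks (γ / 2 / 2) W -
      M.expLoss M.train ks (γ / 2) W))) P
    · calc _ ≤ ∫ _, Real.exp (lam * K) ∂P := by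
            refine integral_mono_ae hint (integrable_const _) ?_
            filter_upwards [hP] with W hW
            have := expLoss_test_le hC hσ M e hB hs ks (γ := γ / 2 / 2) (γ' := γ / 2) hW
              (by linarith)
            refine Real.exp_le_exp.2 (mul_le_mul_of_nonneg_left ?_ hlam.le)
            linarith
        _ = _ := by simp
    -- A non-integrable exponential has integral `0` by convention.
    · rw [integral_undef hint]
      positivity
  unfold discrepancy
  rcases (integral_nonneg fun W => (Real.exp_pos (lam * (M.expLoss (M.test e) ks (γ / 2 / 2) W -
      M.expLoss M.train ks (γ / 2) W))).le : 0 ≤ ∫ W, Real.exp (lam * (M.expLoss (M.test e) ks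
      (γ / 2 / 2) W - M.expLoss M.train ks (γ / 2) W)) ∂P).eq_or_lt with h | h
  -- The logarithm of `0` is `0` by convention, and the bound is nonnegative.
  · rw [← h, Real.log_zero]
    positivity
  · exact (Real.log_le_log h hle).trans_eq (Real.log_exp _)

end CSBM

namespace CSBM

variable {d C : ℕ} {σ : ℝ}

/-! ### Uniform deviation of the empirical margin loss -/

theorem isProbabilityMeasure_labelLaw (hC : 0 < C) (hσ : 0 < σ) (M : CSBM d C σ)
    (E : Environment d C) : IsProbabilityMeasure (M.labelLaw E) := by
  have := isProbabilityMeasure_nodeLabelLaw hC hσ M E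
  unfold labelLaw
  infer_instance

/-- The labels are independent, and a variable with values in `[0, 1]` has variance at most `1/4`.
-/
theorem variance_empLoss_le (hC : 0 < C) (hσ : 0 < σ) (M : CSBM d C σ) (E : Environment d C)
    (ks : List ℕ) (γ : ℝ) (W : Params C (Fin d ⊕ Fin d) ks) :
    variance (empLoss E ks γ W) (M.labelLaw E) ≤ 1 / (4 * E.size) := by
  have := isProbabilityMeasure_nodeLabelLaw hC hσ M E
  have hN := size_pos E
  have h1 : empLoss E ks γ W = fun y => (1 / (E.size : ℝ)) *
      (∑ i, fun y : E.V → Fin C => marginLoss γ (logits E ks W i) (y i)) y := by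
    funext y
    simp [empLoss]
  have h2 : ∀ i, variance (marginLoss γ (logits E ks W i)) (M.nodeLabelLaw E i) ≤ 1 / 4 :=
    fun i => (variance_le_sq_of_bounded (a := 0) (b := 1) (Filter.Eventually.of_forall fun c =>
      ⟨marginLoss_nonneg _ _ _, marginLoss_le_one _ _ _⟩) (by fun_prop)).trans (by norm_num)
  rw [h1, variance_const_mul]
  unfold labelLaw
  rw [variance_sum_pi (X := fun i => marginLoss γ (logits E ks W i)) fun i => MemLp.of_discrete]
  calc _ ≤ (1 / (E.size : ℝ)) ^ 2 * ∑ _i : E.V, (1 / 4 : ℝ) := by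
        gcongr with i
        exact h2 i
    _ = 1 / (4 * E.size) := by
        rw [Finset.sum_const, Finset.card_univ, nsmul_eq_mul]
        change _ * ((E.size : ℝ) * _) = _
        field_simp

theorem labelLaw_le_expLoss_sub_empLoss (hC : 0 < C) (hσ : 0 < σ) (M : CSBM d C σ)
    (E : Environment d C) (ks : List ℕ) (γ : ℝ) (W : Params C (Fin d ⊕ Fin d) ks) {t : ℝ}
    (ht : 0 < t) : (M.labelLaw E).real {y | t ≤ M.expLoss E ks γ W - empLoss E ks γ W y} ≤
      1 / (4 * E.size * t ^ 2) := by
  have := isProbabilityMeasure_labelLaw hC hσ M E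
  have hN := size_pos E
  have h := meas_ge_le_variance_div_sq (μ := M.labelLaw E) (X := empLoss E ks γ W)
    MemLp.of_discrete ht
  refine ENNReal.toReal_le_of_le_ofReal (by positivity) ?_
  refine (measure_mono fun y hy => ?_).trans (h.trans (ENNReal.ofReal_le_ofReal ?_))
  · change t ≤ |empLoss E ks γ W y - M.expLoss E ks γ W|
    rw [abs_sub_comm]
    exact le_trans hy (le_abs_self _)
  · rw [← div_div]
    exact div_le_div_of_nonneg_right (variance_empLoss_le hC hσ M E ks γ W) (by positivity)

theorem le_labelLaw_forall_mem (hC : 0 < C) (hσ : 0 < σ) (M : CSBM d C σ)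
    (E : Environment d C) (ks : List ℕ) (γ : ℝ) (F : Finset (Params C (Fin d ⊕ Fin d) ks))
    {t : ℝ} (ht : 0 < t) : 1 - F.card * (1 / (4 * E.size * t ^ 2)) ≤
      (M.labelLaw E).real {y | ∀ W ∈ F, M.expLoss E ks γ W < empLoss E ks γ W y + t} := by
  have := isProbabilityMeasure_labelLaw hC hσ M E
  have h1 : {y | ∀ W ∈ F, M.expLoss E ks γ W < empLoss E ks γ W y + t}ᶜ =
      ⋃ W ∈ F, {y | t ≤ M.expLoss E ks γ W - empLoss E ks γ W y} := by
    ext y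
    simp [le_sub_iff_add_le']
  have h2 := measureReal_biUnion_finset_le (μ := M.labelLaw E) F
    fun W => {y | t ≤ M.expLoss E ks γ W - empLoss E ks γ W y}
  have h3 : ∑ W ∈ F, (M.labelLaw E).real {y | t ≤ M.expLoss E ks γ W - empLoss E ks γ W y} ≤
      F.card * (1 / (4 * E.size * t ^ 2)) := by
    rw [← nsmul_eq_mul]
    exact Finset.sum_le_card_nsmul _ _ _ fun W _ =>
      labelLaw_le_expLoss_sub_empLoss hC hσ M E ks γ W ht
  rw [← h1, probReal_compl_eq_one_sub (Set.Finite.measurableSet (Set.toFinite _))] at h2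
  linarith

theorem exists_close_logits (C d : ℕ) (ks : List ℕ) {R B η : ℝ} (hR : 0 ≤ R) (hB : 0 ≤ B)
    (hη : 0 < η) : ∃ ρ : ℝ, 0 < ρ ∧ ∀ W W' : Params C (Fin d ⊕ Fin d) ks,
      Params.EntriesLE R ks W → Params.EntriesLE R ks W' → Params.Close ρ ks W W' →
      ∀ (E : Environment d C) (i : E.V), ‖E.agg i‖ ≤ B →
        ∀ c, |logits E ks W i c - logits E ks W' i c| ≤ η := by
  obtain ⟨ρ, hρ, h⟩ := Params.exists_close_apply (C := C) hR (Fin d ⊕ Fin d) ks hB hη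
  refine ⟨ρ, hρ, fun W W' hW hW' hWW E i hi c => h W W' hW hW' hWW _ _ (fun a => ?_)
    (fun a => by simpa using hρ.le) c⟩
  exact (PiLp.norm_apply_le (E.agg i) a).trans hi

/-- Union bound at the middle margin `(γ + γ') / 2`. Half of the gap pays for passing to a net
point, the other half for returning. The net size `n` does not depend on the environment, hence not
on its number of nodes. -/
theorem exists_le_labelLaw_forall (hC : 2 ≤ C) (hσ : 0 < σ) (d : ℕ) (ks : List ℕ) {R B γ γ' : ℝ}
    (hR : 0 ≤ R) (hB : 0 ≤ B) (hγ : γ < γ') :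
    ∃ n : ℕ, ∀ (M : CSBM d C σ) (E : Environment d C), (∀ i, ‖E.agg i‖ ≤ B) → ∀ t : ℝ, 0 < t →
      1 - n * (1 / (4 * E.size * t ^ 2)) ≤
        (M.labelLaw E).real {y | ∀ W : Params C (Fin d ⊕ Fin d) ks,
          Params.maxSpecNorm ks W ≤ R → M.expLoss E ks γ W ≤ empLoss E ks γ' W y + t} := by
  obtain ⟨ρ, hρ, hclose⟩ := exists_close_logits C d ks hR hB
    (show 0 < (γ' - γ) / 4 by linarith)
  obtain ⟨F, hF, hFR, hFr⟩ := Params.exists_finite_net (C := C) R hρ (Fin d ⊕ Fin d) ks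
  refine ⟨hF.toFinset.card, fun M E hE t ht => ?_⟩
  have := isProbabilityMeasure_labelLaw (by omega) hσ M E
  refine (le_labelLaw_forall_mem (by omega) hσ M E ks ((γ + γ') / 2) hF.toFinset ht).trans
    (measureReal_mono fun y hy W hW => ?_)
  have hWR := Params.entriesLE_of_maxSpecNorm_le ks hW
  obtain ⟨W', hW', hWW⟩ := hFr W hWR
  have hc := hclose W W' hWR (hFR W' hW') hWW E
  have h1 := expLoss_le_expLoss hC hσ M E ks (γ' := (γ + γ') / 2) (fun i => hc i (hE i))
    (by linarith : γ + 2 * ((γ' - γ) / 4) ≤ _)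
  have h2 := empLoss_le_empLoss hC E ks (γ := (γ + γ') / 2) (γ' := γ') (W := W') (W' := W)
    (fun i c => by rw [abs_sub_comm]; exact hc i (hE i) c) (by linarith) y
  have h3 := hy W' (hF.mem_toFinset.2 hW')
  linarith

/-! ### The prior variance -/

theorem one_le_maxWidth {ks : List ℕ} (hks : ks ≠ []) (hpos : ∀ k ∈ ks, 0 < k) :
    1 ≤ maxWidth ks := by
  cases ks with
  | nil => exact absurd rfl hks
  | cons k ks => exact (hpos k (by simp)).trans_le (le_max_left k (maxWidth ks))

theorem depth_pos (ks : List ℕ) : (0 : ℝ) < depth ks := by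
  unfold depth; positivity

theorem one_le_two_mul_maxWidth_mul_depth {ks : List ℕ} (hks : 1 ≤ maxWidth ks) :
    (1 : ℝ) ≤ 2 * maxWidth ks * depth ks := by
  have h1 : (1 : ℝ) ≤ maxWidth ks := by exact_mod_cast hks
  have h2 : (1 : ℝ) ≤ depth ks := by simp [depth]
  nlinarith

theorem rpow_two_div_depth (ks : List ℕ) {x : ℝ} (hx : 0 ≤ x) :
    (x ^ depth ks) ^ (2 / (depth ks : ℝ)) = x ^ 2 := by
  rw [← Real.rpow_natCast x, ← Real.rpow_mul hx, mul_div_cancel₀ _ (depth_pos ks).ne',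
    ← Real.rpow_natCast x 2]
  norm_num

/-- Raising `T_h^L ε > γ/8` to the power `2/L` leaves `T_h²`, which the sum of squared Frobenius
norms dominates. -/
theorem rpow_neg_le_termD (M : CSBM d C σ) (e : M.Test) {ks : List ℕ} (hks : 1 ≤ maxWidth ks)
    {γ : ℝ} (hγ : 0 < γ) (α : ℝ) {W : Params C (Fin d ⊕ Fin d) ks}
    (hW : γ / 8 < Params.maxSpecNorm ks W ^ depth ks * M.dist e) :
    (M.train.size : ℝ) ^ (-α) ≤ M.termD e ks γ α W := by
  have hN := size_pos M.train
  have hT := Params.maxSpecNorm_nonneg ks W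
  have hε := dist_nonneg M e
  have hb : (1 : ℝ) ≤ maxWidth ks := by exact_mod_cast hks
  have hF := Params.maxSpecNorm_sq_le ks W
  have h1 : (γ / 8) ^ (2 / (depth ks : ℝ)) ≤
      maxWidth ks * Params.sumFrobSq ks W * M.dist e ^ (2 / (depth ks : ℝ)) := by
    calc _ ≤ (Params.maxSpecNorm ks W ^ depth ks * M.dist e) ^ (2 / (depth ks : ℝ)) :=
          Real.rpow_le_rpow (by positivity) hW.le (by positivity)
      _ = Params.maxSpecNorm ks W ^ 2 * M.dist e ^ (2 / (depth ks : ℝ)) := by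
          rw [Real.mul_rpow (by positivity) hε, rpow_two_div_depth ks hT]
      _ ≤ _ := by
          refine mul_le_mul_of_nonneg_right ?_ (Real.rpow_nonneg hε _)
          nlinarith [Params.sumFrobSq_nonneg ks W]
  have h2 : 0 < (γ / 8) ^ (2 / (depth ks : ℝ)) := by positivity
  have h3 : 0 < (M.train.size : ℝ) ^ α := by positivity
  unfold termD
  rw [Real.rpow_neg hN.le, div_mul_eq_mul_div, le_div_iff₀ (by positivity), mul_left_comm,
    inv_mul_cancel₀ h3.ne', mul_one]
  exact h1

theorem termD_nonneg (M : CSBM d C σ) (e : M.Test) (ks : List ℕ)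
    {γ : ℝ} (hγ : 0 < γ) (α : ℝ) (W : Params C (Fin d ⊕ Fin d) ks) :
    0 ≤ M.termD e ks γ α W := by
  have hε := dist_nonneg M e
  have := Params.sumFrobSq_nonneg ks W
  unfold termD
  positivity

/-- Bounds of the prior variance when some perceptron with `T_h ≤ R` has `T_h ^ L * ε > γ / 8`. -/
theorem priorVarBound_bounds (M : CSBM d C σ) (e : M.Test) {ks : List ℕ} (hks : 1 ≤ maxWidth ks)
    {γ α R : ℝ} (hγ : 0 < γ) (hα : 0 < α) (hR : 0 ≤ R) (hε : 0 < M.dist e)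
    (hRε : γ / 8 ≤ R ^ depth ks * M.dist e) :
    (γ / (16 * M.maxNorm e)) ^ (2 / (depth ks : ℝ)) /
        (2 * maxWidth ks * (1 + Real.log (2 * maxWidth ks * depth ks)) *
          (M.train.size : ℝ) ^ α) ≤ M.priorVarBound e ks γ α ∧
      M.priorVarBound e ks γ α ≤ R ^ 2 := by
  have hN : (1 : ℝ) ≤ M.train.size := by
    exact_mod_cast (Fintype.card_pos : 0 < Fintype.card M.train.V)
  have hb : (1 : ℝ) ≤ maxWidth ks := by exact_mod_cast hks
  have hlog := Real.log_nonneg (one_le_two_mul_maxWidth_mul_depth hks)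
  set l := Real.log (2 * maxWidth ks * depth ks) with hl
  have hx : 1 ≤ (M.train.size : ℝ) ^ α := Real.one_le_rpow hN hα.le
  have hxx : (M.train.size : ℝ) ^ (2 * α) * (M.train.size : ℝ) ^ (-α) =
      (M.train.size : ℝ) ^ α := by
    rw [← Real.rpow_add (by linarith)]; ring_nf
  have hB : 0 < M.maxNorm e := by linarith [dist_le M e]
  unfold priorVarBound
  rw [hxx]
  set x := (M.train.size : ℝ) ^ α with hxdef
  constructor
  · have h1 : γ / (16 * M.maxNorm e) ≤ γ / (8 * M.dist e) := by
      have := dist_le M e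
      exact div_le_div_of_nonneg_left hγ.le (by positivity) (by linarith)
    refine div_le_div₀ (by positivity) (Real.rpow_le_rpow (by positivity) h1 (by positivity))
      (by positivity) ?_
    have h2 : x + l ≤ (1 + l) * x := by nlinarith
    have := mul_le_mul_of_nonneg_left h2 (by positivity : (0 : ℝ) ≤ 2 * maxWidth ks)
    linarith
  · have h1 : γ / (8 * M.dist e) ≤ R ^ depth ks := by
      rw [div_le_iff₀ (by positivity)]
      linarith
    have h2 : (γ / (8 * M.dist e)) ^ (2 / (depth ks : ℝ)) ≤ R ^ 2 := by
      rw [← rpow_two_div_depth ks hR]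
      exact Real.rpow_le_rpow (by positivity) h1 (by positivity)
    refine (div_le_self (by positivity) ?_).trans h2
    nlinarith

/-! ### Perceptrons with large weights -/

/-- Conditioning on `S` can only increase the mass of a subset of `S`, so `Q` is too heavy to lie
inside `A`. -/
theorem exists_mem_notMem_of_cond_real_lt {Ω : Type*} [MeasurableSpace Ω] {P : Measure Ω}
    [IsProbabilityMeasure P] {S A Q : Set Ω} (hQ : MeasurableSet Q) (hQS : Q ⊆ S) {c : ℝ}
    (hA : (cond P S).real A < c) (hc : ENNReal.ofReal c ≤ P Q) : ∃ x ∈ Q, x ∉ A := by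
  by_contra! h
  have hc0 : 0 < c := measureReal_nonneg.trans_lt hA
  have hS : P S ≠ 0 := fun h0 => by
    have := hc.trans ((measure_mono hQS).trans_eq h0)
    rw [nonpos_iff_eq_zero, ENNReal.ofReal_eq_zero] at this
    linarith
  have := cond_isProbabilityMeasure hS
  have h1 : ENNReal.ofReal c ≤ cond P S A := by
    refine le_trans ?_ (measure_mono h)
    rw [cond_apply' hQ, Set.inter_eq_right.2 hQS]
    refine hc.trans (le_mul_of_one_le_left zero_le ?_)
    exact ENNReal.one_le_inv.2 prob_le_one
  have h2 := ENNReal.toReal_mono (measure_ne_top _ _) h1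
  rw [ENNReal.toReal_ofReal hc0.le] at h2
  exact absurd hA (not_lt.2 h2)

open Filter in
theorem eventually_exp_neg_sq_lt {a : ℝ} (ha : 0 < a) (b : ℝ) (n : ℕ) :
    ∀ᶠ x : ℝ in atTop, Real.exp (-x ^ 2) < (a * Real.exp (-(b * x))) ^ n := by
  filter_upwards [eventually_ge_atTop (n * |b| + n * |Real.log a| + 1)] with x hx
  have h0 : (0 : ℝ) ≤ n * |b| := by positivity
  have h0' : (0 : ℝ) ≤ n * |Real.log a| := by positivity
  have e : (a * Real.exp (-(b * x))) ^ n = Real.exp (n * (Real.log a - b * x)) := by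
    rw [Real.exp_nat_mul, sub_eq_add_neg, Real.exp_add, Real.exp_log ha]
  rw [e, Real.exp_lt_exp]
  have h1 : n * (b * x) ≤ n * |b| * x := by
    rw [mul_assoc]
    have : b ≤ |b| := le_abs_self b
    have hx0 : 0 ≤ x := by linarith
    gcongr
  have h2 : -(n * |Real.log a|) ≤ n * Real.log a := by
    rw [← mul_neg]
    exact mul_le_mul_of_nonneg_left (neg_abs_le _) (by positivity)
  nlinarith [mul_le_mul_of_nonneg_right hx (by linarith : (0 : ℝ) ≤ x)]

theorem eventually_size_rpow {p : ℝ → Prop} {α : ℝ} (hα : 0 < α)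
    (h : ∀ᶠ x : ℝ in Filter.atTop, p x) : ∃ N₀ : ℕ, ∀ N : ℕ, N₀ ≤ N → p ((N : ℝ) ^ α) :=
  Filter.eventually_atTop.1
    (((tendsto_rpow_atTop hα).comp tendsto_natCast_atTop_atTop).eventually h)

/-- With `x = N^α`, the hypothesis `1/v ≤ a x` makes each weight cost at most a factor `exp(O(x))`.
The number of weights is fixed, so the box mass eventually exceeds `exp(-x²)`. The bound `v ≤ V`
controls the density prefactor. -/
theorem exists_lt_gaussian_box (C : ℕ) (ι : Type) [Fintype ι] (ks : List ℕ) {R V r α : ℝ} (a : ℝ)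
    (hV : 0 < V) (hr : 0 < r) (hα : 0 < α) :
    ∃ N₀ : ℕ, ∀ N : ℕ, N₀ ≤ N → ∀ v : ℝ, 0 < v → v ≤ V → 1 / v ≤ a * (N : ℝ) ^ α →
      ∃ c : ℝ, Real.exp (-(N : ℝ) ^ (2 * α)) < c ∧ ∀ W : Params C ι ks, Params.EntriesLE R ks W →
        ENNReal.ofReal c ≤ Params.gaussian v.toNNReal ks (Params.box r ks W) := by
  obtain ⟨n, hn⟩ := Params.exists_pow_le_gaussian_box (C := C) ι ks
  obtain ⟨N₀, hN₀⟩ := eventually_size_rpow hα (eventually_exp_neg_sq_lt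
    (a := 2 * r * (Real.sqrt (2 * Real.pi * V))⁻¹) (by positivity) ((R + r) ^ 2 / 2 * a) n)
  refine ⟨N₀, fun N hN v hv hvV hva => ?_⟩
  set p := 2 * r * (Real.sqrt (2 * Real.pi * V))⁻¹ *
    Real.exp (-((R + r) ^ 2 / 2 * a * (N : ℝ) ^ α)) with hp
  have hp0 : 0 < p := by positivity
  have hball : ∀ x : ℝ, |x| ≤ R → ENNReal.ofReal p ≤
      gaussianReal 0 v.toNNReal (Set.Icc (x - r) (x + r)) := fun x hx => by
    refine le_trans (ENNReal.ofReal_le_ofReal ?_)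
      (Params.le_gaussianReal_Icc (by simpa using hv) hr.le hx)
    rw [Real.coe_toNNReal v hv.le, hp, mul_assoc (2 * r)]
    refine mul_le_mul_of_nonneg_left ?_ (by positivity)
    refine mul_le_mul ?_ (Real.exp_le_exp.2 ?_) (by positivity) (by positivity)
    · gcongr
    · rw [neg_div]
      refine neg_le_neg ?_
      calc (R + r) ^ 2 / (2 * v) = (R + r) ^ 2 / 2 * (1 / v) := by field_simp
        _ ≤ (R + r) ^ 2 / 2 * (a * (N : ℝ) ^ α) := by gcongr
        _ = _ := by ring
  refine ⟨p ^ n, ?_, fun W hW => ?_⟩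
  · have := hN₀ N hN
    rwa [← Real.rpow_natCast ((N : ℝ) ^ α) 2, ← Real.rpow_mul (by positivity),
      mul_comm α, Nat.cast_ofNat] at this
  · rw [ENNReal.ofReal_pow hp0.le]
    exact hn _ r R _ hball W hW

/-- Perturbing a scaled-up perceptron keeps it near the original one, and does not decrease
the largest spectral norm. -/
theorem exists_scale_box (C : ℕ) (ι : Type) [Fintype ι] [DecidableEq ι] (ks : List ℕ)
    {R ρ τ : ℝ} (hR : 1 ≤ R) (hρ : 0 < ρ) (hτ : 0 < τ) :
    ∃ θ r : ℝ, 0 < r ∧ ∀ W : Params C ι ks, Params.maxSpecNorm ks W ≤ R →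
      τ < Params.maxSpecNorm ks W →
      Params.EntriesLE (2 * R) ks (Params.scale (1 + θ) ks W) ∧
      ∀ W' ∈ Params.box r ks (Params.scale (1 + θ) ks W),
        Params.maxSpecNorm ks W ≤ Params.maxSpecNorm ks W' ∧ Params.Close ρ ks W W' ∧
          Params.EntriesLE (3 * R) ks W' := by
  obtain ⟨D, hD, hspec⟩ := Params.exists_maxSpecNorm_le_add (C := C) ι ks
  set θ := min 1 (ρ / (2 * R)) with hθ
  have hθ0 : 0 < θ := by positivity
  have hθ1 : θ ≤ 1 := min_le_left _ _
  have hθρ : θ * R ≤ ρ / 2 := by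
    have := mul_le_mul_of_nonneg_right (min_le_right 1 (ρ / (2 * R))) (by linarith : 0 ≤ R)
    refine this.trans_eq ?_
    field_simp
  -- The last entry makes the loss `D r` of spectral norm smaller than the gain `θ τ` from scaling;
  -- the others keep the box within `ρ` of `W` and its entries below `3 R`.
  set r := min 1 (min (ρ / 2) (θ * τ / (2 * D))) with hr
  have hr0 : 0 < r := by positivity
  have hr1 : r ≤ 1 := min_le_left _ _
  have hrρ : r ≤ ρ / 2 := (min_le_right _ _).trans (min_le_left _ _)
  have hrD : D * r < θ * τ := by
    have h1 : r ≤ θ * τ / (2 * D) := (min_le_right _ _).trans (min_le_right _ _)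
    have h2 := mul_le_mul_of_nonneg_left h1 hD.le
    have h3 : D * (θ * τ / (2 * D)) = θ * τ / 2 := by field_simp
    have : 0 < θ * τ := by positivity
    linarith
  refine ⟨θ, r, hr0, fun W hWR hτT => ?_⟩
  set W₁ := Params.scale (1 + θ) ks W with hW₁
  have hWent := Params.entriesLE_of_maxSpecNorm_le ks hWR
  have hWW₁ := Params.close_scale hθ0.le ks hWent
  have hW₁ent : Params.EntriesLE (2 * R) ks W₁ :=
    (hWent.of_close ks hWW₁).mono (by nlinarith) ks
  refine ⟨hW₁ent, fun W' hW' => ⟨?_, ?_, ?_⟩⟩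
  · have h1 := hspec r hr0.le W₁ W' (Params.close_of_mem_box ks hW')
    rw [hW₁, Params.maxSpecNorm_scale (by linarith)] at h1
    nlinarith
  · exact (hWW₁.trans ks (Params.close_of_mem_box ks hW')).mono (by linarith) ks
  · exact (hW₁ent.of_close ks (Params.close_of_mem_box ks hW')).mono (by linarith) ks

/-- The box is centred at a scaled-up copy of `W`, because `W` may lie near the boundary of the
conditioning event and a box around `W` itself could leave it. Passing to the good network `W'` and
back costs `γ/4` of margin each time: `0` to `γ/4` on the test side, `γ/2` to `3γ/4` on the training
side. -/
theorem exists_expLoss_test_le_of_concentrated (hC : 2 ≤ C) (hσ : 0 < σ) {B H κ : ℝ} (hB : 0 < B)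
    (hκ : 0 < κ) (d : ℕ) {ks : List ℕ} (hks : 1 ≤ maxWidth ks) {γ α R : ℝ}
    (hγ : 0 < γ) (hα : 0 < α) (hR : 1 ≤ R) :
    ∃ N₀ : ℕ, ∀ (M : CSBM d C σ) (e : M.Test), N₀ ≤ M.train.size → M.maxNorm e = B →
      M.Concentrated e ks γ α H κ → ∀ W : Params C (Fin d ⊕ Fin d) ks,
        Params.maxSpecNorm ks W ≤ R → γ / 8 < Params.maxSpecNorm ks W ^ depth ks * M.dist e →
        M.expLoss (M.test e) ks 0 W ≤ M.expLoss M.train ks (3 * γ / 4) W +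
          ((M.train.size : ℝ) ^ (-α) + H * C * M.dist e) := by
  obtain ⟨ρ, hρ, hclose⟩ := exists_close_logits C d ks (R := 3 * R) (by linarith) hB.le
    (show 0 < γ / 8 by linarith)
  -- From `T^L ε > γ/8`, `ε ≤ 2B` and `T^(L-1) ≤ R^(L-1)`, every relevant network has `T > τ`,
  -- uniformly over the models.
  set τ := γ / (16 * B * R ^ ks.length) with hτ
  have hτ0 : 0 < τ := by positivity
  obtain ⟨θ, r, hr0, hscale⟩ := exists_scale_box C (Fin d ⊕ Fin d) ks hR hρ hτ0
  have hl := Real.log_nonneg (one_le_two_mul_maxWidth_mul_depth hks)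
  have hb : (1 : ℝ) ≤ maxWidth ks := by exact_mod_cast hks
  set q := (γ / (16 * B)) ^ (2 / (depth ks : ℝ)) with hq
  have hq0 : 0 < q := by positivity
  set m := 2 * maxWidth ks * (1 + Real.log (2 * maxWidth ks * depth ks)) with hm
  have hm0 : 0 < m := by positivity
  obtain ⟨N₀, hN₀⟩ := exists_lt_gaussian_box C (Fin d ⊕ Fin d) ks (R := 2 * R) (V := R ^ 2)
    (m / (κ * q)) (by positivity) hr0 hα
  refine ⟨N₀, fun M e hN hMB hconc W hWR hW => ?_⟩
  have hNpos := size_pos M.train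
  have hT0 := Params.maxSpecNorm_nonneg ks W
  have hε : 0 < M.dist e := by
    refine (dist_nonneg M e).lt_of_ne fun h => ?_
    rw [← h, mul_zero] at hW
    linarith
  have hεB : M.dist e ≤ 2 * B := hMB ▸ dist_le M e
  have hτT : τ < Params.maxSpecNorm ks W := by
    rw [hτ, div_lt_iff₀ (by positivity)]
    have h1 : Params.maxSpecNorm ks W ^ depth ks ≤
        R ^ ks.length * Params.maxSpecNorm ks W := by
      rw [depth, pow_succ]
      gcongr
    have h2 : Params.maxSpecNorm ks W ^ depth ks * M.dist e ≤
        R ^ ks.length * Params.maxSpecNorm ks W * (2 * B) := by gcongr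
    linarith
  have hRε : γ / 8 ≤ R ^ depth ks * M.dist e :=
    hW.le.trans (by gcongr)
  obtain ⟨v, hv1, hv2, hv⟩ := hconc
  obtain ⟨hlow, hup⟩ := priorVarBound_bounds M e hks hγ hα (by linarith) hε hRε
  rw [hMB] at hlow
  have hx0 : 0 < (M.train.size : ℝ) ^ α := by positivity
  have hvlow : κ * (q / (m * (M.train.size : ℝ) ^ α)) ≤ v :=
    (mul_le_mul_of_nonneg_left hlow hκ.le).trans hv1
  have hvpos : 0 < v := lt_of_lt_of_le (by positivity) hvlow
  have hvup : v ≤ R ^ 2 := hv2.trans hup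
  -- This is where the lower bound `κ` on the variance enters: a much smaller variance would make
  -- the box mass negligible.
  have hvinv : 1 / v ≤ m / (κ * q) * (M.train.size : ℝ) ^ α := by
    rw [div_le_iff₀ hvpos]
    have : m / (κ * q) * (M.train.size : ℝ) ^ α * (κ * (q / (m * (M.train.size : ℝ) ^ α))) = 1 := by
      field_simp
    rw [← this]
    exact mul_le_mul_of_nonneg_left hvlow (by positivity)
  obtain ⟨c, hc, hbox⟩ := hN₀ _ hN v hvpos hvup hvinv
  obtain ⟨hent, hprop⟩ := hscale W hWR hτT
  have hsub : Params.box r ks (Params.scale (1 + θ) ks W) ⊆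
      {W | γ / 8 < Params.maxSpecNorm ks W ^ depth ks * M.dist e} := fun W' hW' => by
    refine hW.trans_le ?_
    have := (hprop W' hW').1
    gcongr
  obtain ⟨W', hW'box, hW'⟩ := exists_mem_notMem_of_cond_real_lt
    (Params.measurableSet_box ks _) hsub (hv.trans_lt hc) (hbox _ hent)
  simp only [Set.mem_ofPred_eq, not_lt] at hW'
  obtain ⟨-, hcl, hW'ent⟩ := hprop W' hW'box
  have hWent := Params.entriesLE_of_maxSpecNorm_le ks hWR
  have hlog := hclose W W' (hWent.mono (by linarith) ks) hW'ent hcl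
  have h1 := expLoss_le_expLoss hC hσ M (M.test e) ks (γ := 0) (γ' := γ / 4)
    (fun i => hlog (M.test e) i (hMB ▸ norm_agg_test_le M e i)) (by linarith)
  have h2 := expLoss_le_expLoss hC hσ M M.train ks (γ := γ / 2) (γ' := 3 * γ / 4)
    (W := W') (W' := W) (η := γ / 8)
    (fun i c => by
      rw [abs_sub_comm]
      exact hlog M.train i (hMB ▸ norm_agg_train_le M e i) c) (by linarith)
  linarith

end CSBM

end SubgroupOOD

end

/-! ### Assembly of the two claims -/

theorem theorem3 (C : ℕ) (hC : 2 ≤ C) (σ B H κ : ℝ) (hσ : 0 < σ) (hB : 0 < B) (hH : 0 ≤ H)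
    (hκ : 0 < κ) (hκ1 : κ ≤ 1) :
    ∃ K : ℝ, 0 < K ∧
      ∀ (d : ℕ) (ks : List ℕ), ks ≠ [] → (∀ k ∈ ks, 0 < k) → ∀ γ : ℝ, 0 < γ →
        -- the bound of the expected loss discrepancy
        (∀ (M : SubgroupOOD.CSBM d C σ) (e : M.Test) (s : ℕ),
          M.maxNorm e = B → M.NearSets e s →
          ∀ (lam : ℝ), 0 < lam →
          ∀ P : MeasureTheory.Measure (SubgroupOOD.Params C (Fin d ⊕ Fin d) ks),
            MeasureTheory.IsProbabilityMeasure P →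
            (∀ᵐ W ∂P, SubgroupOOD.Params.maxSpecNorm ks W ^ SubgroupOOD.depth ks * M.dist e
              ≤ γ / 8) →
            M.discrepancy e ks (γ / 2) lam P
              ≤ lam * (K * (M.termA e + M.termB e + M.termC e s))) ∧
        -- the generalization bound
        (∀ α : ℝ, 0 < α → α < 1 / 4 → ∀ δ : ℝ, 0 < δ → δ < 1 →
          1 < SubgroupOOD.CSBM.logArg C ks B γ δ →
          ∀ R : ℝ, ∃ N₀ : ℕ, ∀ (M : SubgroupOOD.CSBM d C σ) (e : M.Test) (s : ℕ),
            N₀ ≤ M.train.size → M.maxNorm e = B → M.NearSets e s →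
            M.Concentrated e ks γ α H κ →
            1 - δ ≤ (M.labelLaw M.train).real
              {y | ∀ W : SubgroupOOD.Params C (Fin d ⊕ Fin d) ks,
                SubgroupOOD.Params.maxSpecNorm ks W ≤ R →
                M.expLoss (M.test e) ks 0 W ≤ SubgroupOOD.empLoss M.train ks γ W y +
                  K * (M.termA e + M.termB e + M.termC e s + M.termD e ks γ α W +
                    M.termConst e ks γ α δ)}) := by
  -- `K₁` serves the deterministic comparison, `K₂` converts `H C ε` into (a), and the final `1`
  -- covers (d) and the constant term.
  set K₁ : ℝ := 16 * (B + 2) + (B + 2) / B with hK₁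
  have hK₁0 : 0 < K₁ := by positivity
  set K₂ : ℝ := H * C * σ ^ 2 with hK₂
  have hK₂0 : 0 ≤ K₂ := by positivity
  refine ⟨K₁ + K₂ + 1, by positivity, fun d ks hks hkpos γ hγ => ⟨?_, ?_⟩⟩
  · intro M e s hMB hs lam hlam P hP hPT
    have hMB0 : 0 < M.maxNorm e := hMB ▸ hB
    have h := SubgroupOOD.CSBM.discrepancy_le hC hσ M e hMB0 hs ks hlam hPT
    rw [hMB, ← hK₁] at h
    refine h.trans (mul_le_mul_of_nonneg_left (mul_le_mul_of_nonneg_right (by linarith) ?_) hlam.le)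
    have := SubgroupOOD.CSBM.termA_nonneg M e
    have := SubgroupOOD.CSBM.termB_nonneg hC M e hMB0.le
    have := SubgroupOOD.CSBM.termC_nonneg M e s
    positivity
  · intro α hα hα4 δ hδ hδ1 hlogArg R
    have hb := SubgroupOOD.CSBM.one_le_maxWidth hks hkpos
    set l := Real.log (SubgroupOOD.CSBM.logArg C ks B γ δ) with hl
    have hl0 : 0 < l := Real.log_pos hlogArg
    obtain ⟨n, hn⟩ := SubgroupOOD.CSBM.exists_le_labelLaw_forall hC hσ d ks (R := max R 1)
      (B := B) (γ := 3 * γ / 4) (γ' := γ) (by positivity) hB.le (by linarith)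
    obtain ⟨N₁, hN₁⟩ := SubgroupOOD.CSBM.exists_expLoss_test_le_of_concentrated hC hσ (H := H)
      hB hκ d hb hγ hα (le_max_right R 1)
    -- At deviation `t = l / N^(2α)`, Chebyshev on the net fails with probability at most `n / (4
    -- N^(1-4α) l²)`; since `α < 1/4`, this is at most `δ` for large `N`.
    obtain ⟨N₂, hN₂⟩ := SubgroupOOD.CSBM.eventually_size_rpow (α := 1 - 4 * α) (by linarith)
      (Filter.eventually_ge_atTop (n / (4 * l ^ 2 * δ)))
    refine ⟨max N₁ N₂, fun M e s hN hMB hs hconc => ?_⟩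
    have := SubgroupOOD.CSBM.isProbabilityMeasure_labelLaw (by omega) hσ M M.train
    have hMB0 : 0 < M.maxNorm e := hMB ▸ hB
    have hNpos := SubgroupOOD.CSBM.size_pos M.train
    set N : ℝ := (M.train.size : ℝ) with hNdef
    set t := 1 / N ^ (2 * α) * l with ht
    have ht0 : 0 < t := by positivity
    have hNt : N * t ^ 2 = N ^ (1 - 4 * α) * l ^ 2 := by
      have h1 : N ^ (1 - 4 * α) = N * ((N ^ (2 * α)) ^ 2)⁻¹ := by
        rw [← Real.rpow_natCast (N ^ (2 * α)) 2, ← Real.rpow_mul hNpos.le, Real.rpow_sub hNpos,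
          Real.rpow_one, div_eq_mul_inv]
        congr 3
        push_cast
        ring
      rw [ht, h1, mul_pow, one_div, inv_pow]
      ring
    have hfail : n * (1 / (4 * N * t ^ 2)) ≤ δ := by
      have h1 := hN₂ _ ((le_max_right _ _).trans hN)
      rw [div_le_iff₀ (by positivity)] at h1
      rw [mul_one_div, mul_assoc, hNt, div_le_iff₀ (by positivity)]
      linarith
    refine le_trans (by linarith) ((hn M M.train
      (fun i => hMB ▸ SubgroupOOD.CSBM.norm_agg_train_le M e i) t ht0).trans
      (MeasureTheory.measureReal_mono fun y hy W hW => ?_))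
    have hy' := hy W (hW.trans (le_max_left _ _))
    have hA := SubgroupOOD.CSBM.termA_nonneg M e
    have hBt := SubgroupOOD.CSBM.termB_nonneg hC M e hMB0.le
    have hCt := SubgroupOOD.CSBM.termC_nonneg M e s
    have hD := SubgroupOOD.CSBM.termD_nonneg M e ks hγ α W
    -- The deviation `t` is exactly the logarithmic summand; the other summand is only nonnegative
    -- slack.
    have hconst : t ≤ M.termConst e ks γ α δ := by
      unfold SubgroupOOD.CSBM.termConst
      rw [hMB]
      have : 0 ≤ 1 / (M.train.size : ℝ) ^ (1 - 2 * α) := by positivity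
      linarith
    have hAε : M.dist e ≤ σ ^ 2 * M.termA e := by
      have h1 := mul_le_mul_of_nonneg_left
        (SubgroupOOD.CSBM.two_mul_dist_le_termA hC hσ M e) (sq_nonneg σ)
      have h2 : σ ^ 2 * (2 / σ ^ 2 * M.dist e) = 2 * M.dist e := by field_simp
      linarith [SubgroupOOD.CSBM.dist_nonneg M e]
    set S := M.termA e + M.termB e + M.termC e s with hS
    set c := M.termConst e ks γ α δ with hc
    set D := M.termD e ks γ α W with hDdef
    have hK : K₁ * S + K₂ * M.termA e + D + c ≤ (K₁ + K₂ + 1) * (S + D + c) := by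
      have hAS : M.termA e ≤ S := by linarith
      have := mul_le_mul_of_nonneg_left hAS hK₂0
      have : 0 ≤ (K₁ + K₂) * (D + c) :=
        mul_nonneg (by positivity) (add_nonneg hD (ht0.le.trans hconst))
      nlinarith
    have hS0 : 0 ≤ K₁ * S := by positivity
    have hA0 : 0 ≤ K₂ * M.termA e := by positivity
    refine le_trans ?_ (add_le_add le_rfl hK)
    rcases le_or_gt (SubgroupOOD.Params.maxSpecNorm ks W ^ SubgroupOOD.depth ks * M.dist e)
      (γ / 8) with h | h
    · have h1 := SubgroupOOD.CSBM.expLoss_test_le hC hσ M e hMB0 hs ks (γ := 0)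
        (γ' := 3 * γ / 4) h (by linarith)
      rw [hMB, ← hK₁] at h1
      linarith
    · have h1 := hN₁ M e ((le_max_left _ _).trans hN) hMB hconc W (hW.trans (le_max_left _ _)) h
      have h2 := SubgroupOOD.CSBM.rpow_neg_le_termD M e hb hγ α h
      have h3 := mul_le_mul_of_nonneg_left hAε (by positivity : 0 ≤ H * C)
      rw [← mul_assoc] at h3
      linarith
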